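/- Encode an $n$-vertex tournament on $[n]$ as a string $T\in\{0,1\}^{\binom n2}$ with one bit per pair $\{i,j\}$, $i\neq j$, giving the direction of the edge between $i$ and $j$. Let $d^+(v)$ be the out-degree of $v$ in $T$, and let $\mathsf{MOD}_n\subseteq\{0,1\}^{\binom n2}\times[n]$ be the set of pairs $(T,v)$ with $d^+(v)\ge d^+(w)$ for all $w\in[n]$. For a relation $f\subseteq\{0,1\}^m\times\mathcal R$, a quantum query algorithm with $t$ queries starts in an input-independent unit vector $|\psi_0\rangle$ of a finite-dimensional space with basis $|i\rangle|b\rangle|w\rangle$ ($i\in\{0,1,\dots,m\}$, $b\in\{0,1\}$, $w$ in an arbitrary finite workspace), applies $U_0,O_x,U_1,O_x,\dots,O_x,U_t$ with $t$ applications of $O_x$, where the unitaries $U_j$ do not depend on the input $x$ and $O_x|i\rangle|b\rangle|w\rangle=|i\rangle|b\oplus x_i\rangle|w\rangle$ for $i\ge1$, $O_x|0\rangle|b\rangle|w\rangle=|0\rangle|b\rangle|w\rangle$, then measures in the computational basis and outputs an element of $\mathcal R$ that is a fixed function of the outcome. The bounded-error quantum query complexity $\mathsf Q(f)$ is the least $t$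 for which some such algorithm outputs, on every input $x\in\{0,1\}^m$, with probability at least $2/3$ an element $r$ with $(x,r)\in f$. Theorem. $\mathsf Q(\mathsf{MOD}_n)=O(n^{3/2})$ and $\mathsf Q(\mathsf{MOD}_n)=\Omega(n)$. That is, there are absolute constants $c,C>0$ such that $\mathsf Q(\mathsf{MOD}_n)\le C\,n^{3/2}$ for all integers $n\ge1$, and $\mathsf Q(\mathsf{MOD}_n)\ge c\,n$ for all integers $n\ge2$. -/

import Mathlib

open scoped ENNReal NNReal

noncomputable section

namespace QuantumQuery

/-- Labels of the computational basis: a query index (`none` is the index `0`, at which nothing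
is queried), a query bit, and a basis label of the workspace. -/
abbrev BasisLabel (ι W : Type) : Type := Option ι × Bool × W

/-- The finite-dimensional Hilbert space on which a query algorithm acts. -/
abbrev StateSpace (ι W : Type) [Fintype ι] [Fintype W] : Type :=
  EuclideanSpace ℂ (BasisLabel ι W)

/-- The action of a query to `x` on the basis labels: `(i, b, w) ↦ (i, b ⊕ xᵢ, w)`, and
`(0, b, w) ↦ (0, b, w)`. -/
def queryFun {ι W : Type} (x : ι → Bool) : BasisLabel ι W → BasisLabel ι W
  | (none, b, w) => (none, b, w)
  | (some i, b, w) => (some i, xor b (x i), w)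

theorem queryFun_involutive {ι W : Type} (x : ι → Bool) :
    Function.Involutive (queryFun (W := W) x) := by
  rintro ⟨_ | i, b, w⟩
  · rfl
  · simp [queryFun]

/-- The query unitary `O_x`, which permutes the computational basis by `queryFun x`. -/
def oracle {ι W : Type} [Fintype ι] [Fintype W] (x : ι → Bool) :
    StateSpace ι W ≃ₗᵢ[ℂ] StateSpace ι W :=
  LinearIsometryEquiv.piLpCongrLeft 2 ℂ ℂ (queryFun_involutive x).toPerm

/-- A quantum query algorithm with query access to a string in `ι → Bool`, outputs in `R` and a
finite workspace: an input-independent unit initial state, input-independent unitaries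
`U 0, U 1, …`, and a classical output for each outcome of the final measurement in the
computational basis. A run with `T` queries uses only `U 0, …, U T`. -/
structure Algorithm (ι R W : Type) [Fintype ι] [Fintype W] where
  init : StateSpace ι W
  norm_init : ‖init‖ = 1
  U : ℕ → (StateSpace ι W ≃ₗᵢ[ℂ] StateSpace ι W)
  out : BasisLabel ι W → R

/-- The state `U_T O_x U_{T-1} O_x ⋯ O_x U_0 |ψ₀⟩` after `T` queries to `x`. -/
def Algorithm.state {ι R W : Type} [Fintype ι] [Fintype W] (A : Algorithm ι R W) (x : ι → Bool) :
    ℕ → StateSpace ι W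
  | 0 => A.U 0 A.init
  | T + 1 => A.U (T + 1) (oracle x (A.state x T))

open Classical in
/-- The probability that the algorithm, run with `T` queries on input `x`, outputs some `r` in
the set `S`. -/
def Algorithm.outputProb {ι R W : Type} [Fintype ι] [Fintype W] (A : Algorithm ι R W)
    (T : ℕ) (x : ι → Bool) (S : Set R) : ℝ :=
  ∑ s : BasisLabel ι W, if A.out s ∈ S then ‖A.state x T s‖ ^ 2 else 0

/-- Some quantum algorithm with `T` queries computes the relation `f` with error at most `1/3` on
every input. -/
def ComputableWith {ι R : Type} [Fintype ι] (f : (ι → Bool) → R → Prop) (T : ℕ) : Prop :=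
  ∃ (W : Type) (_ : Fintype W) (A : Algorithm ι R W),
    ∀ x : ι → Bool, 2 / 3 ≤ A.outputProb T x {r | f x r}

/-- The bounded-error quantum query complexity `Q(f)` of the relation `f` (`⊤` if no algorithm
computes `f`). -/
def Q {ι R : Type} [Fintype ι] (f : (ι → Bool) → R → Prop) : ℕ∞ :=
  ⨅ (T : ℕ) (_ : ComputableWith f T), (T : ℕ∞)

end QuantumQuery

namespace Tournament

/-- The `n.choose 2` edges of the complete graph on `Fin n`: the pairs `i < j`. -/
abbrev Edge (n : ℕ) : Type := {p : Fin n × Fin n // p.1 < p.2}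

/-- `Arc T u v`: the edge between `u` and `v` is directed `u → v` in the tournament described by
the bit string `T`, where the bit of a pair `i < j` is `true` if `i → j` and `false` if `j → i`. -/
def Arc {n : ℕ} (T : Edge n → Bool) (u v : Fin n) : Prop :=
  (∃ h : u < v, T ⟨(u, v), h⟩ = true) ∨ (∃ h : v < u, T ⟨(v, u), h⟩ = false)

open Classical in
/-- The out-degree `d⁺(v)`. -/
def outDegree {n : ℕ} (T : Edge n → Bool) (v : Fin n) : ℕ :=
  (Finset.univ.filter fun u => Arc T v u).card

/-- The relation `MOD_n`: `v` is a vertex of maximum out-degree in `T`. -/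
def MOD (n : ℕ) (T : Edge n → Bool) (v : Fin n) : Prop :=
  ∀ w : Fin n, outDegree T w ≤ outDegree T v

end Tournament

end

/-!
Lower bound, by the hybrid method. In an almost regular tournament, `Ω(n)` vertices have the maximum
out-degree, and the reversal of any of the `Ω(n²)` edges among them makes the vertex that the edge
enters the unique maximum. At most one vertex is output with probability more than `1 / 2` on the
original tournament, so for all but `O(n)` of these edges the reversal must move the final state by
a constant distance, which requires that the edge be queried with total weight `Ω(1 / t)` over the
`t` steps. Each step distributes a total query weight of at most `1`, so `n² = O(t²)`.

Upper bound, by Dürr and Høyer's maximum finding. The `n` bits at a vertex `u` determine its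
out-degree, so Grover's search finds a vertex that beats the best one known. If at most
`9⁻ʲ n` vertices beat it, then `≈ 3ʲ` Grover iterations find each of them with probability
`Ω(9ʲ / n)`; among these, enough have at most `9⁻⁽ʲ⁺¹⁾ n` vertices above them that one attempt
reaches the level `j + 1` with constant probability. Repeating the attempt more often at the lower
levels, which are cheaper, reaches the level `log₉ n + 1`, where no vertex is better, with
`O(3 ^ log₉ n) = O(√n)` iterations of `O(n)` queries each.

Markov kernels describe the classical behaviour of subroutines. The measurements between them are
deferred: the second subroutine is controlled by the basis label that holds the outcome of the first
one, so the composition of kernels is realized by a single algorithm that measures once.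
-/

noncomputable section

namespace QuantumQuery

section Restrict

variable {κ α : Type*}

/-- The orthogonal projection onto the span of the basis vectors with labels in `L`. -/
def restrict (L : Set κ) : EuclideanSpace ℂ κ →ₗ[ℂ] EuclideanSpace ℂ κ where
  toFun ψ := WithLp.toLp 2 (L.indicator ψ)
  map_add' ψ φ := by ext l; exact congrFun (Set.indicator_add L ψ φ) l
  map_smul' c ψ := by ext l; exact congrFun (Set.indicator_const_smul L c ψ) l

theorem restrict_apply (L : Set κ) (ψ : EuclideanSpace ℂ κ) (l : κ) :
    restrict L ψ l = L.indicator ψ l := rfl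

theorem restrict_add_restrict_compl (L : Set κ) (ψ : EuclideanSpace ℂ κ) :
    restrict L ψ + restrict Lᶜ ψ = ψ := by
  ext l
  exact congrFun (Set.indicator_self_add_compl L ψ) l

variable [Fintype κ]

open Classical in
theorem norm_restrict_sq (L : Set κ) (ψ : EuclideanSpace ℂ κ) :
    ‖restrict L ψ‖ ^ 2 = ∑ l, if l ∈ L then ‖ψ l‖ ^ 2 else 0 := by
  rw [EuclideanSpace.norm_sq_eq]
  refine Finset.sum_congr rfl fun l _ => ?_
  by_cases hl : l ∈ L <;> simp [restrict_apply, hl]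

theorem norm_restrict_sq_add_norm_restrict_compl_sq (L : Set κ) (ψ : EuclideanSpace ℂ κ) :
    ‖restrict L ψ‖ ^ 2 + ‖restrict Lᶜ ψ‖ ^ 2 = ‖ψ‖ ^ 2 := by
  classical
  rw [norm_restrict_sq, norm_restrict_sq, ← Finset.sum_add_distrib, EuclideanSpace.norm_sq_eq]
  refine Finset.sum_congr rfl fun l _ => ?_
  by_cases hl : l ∈ L <;> simp [hl]

theorem norm_restrict_le (L : Set κ) (ψ : EuclideanSpace ℂ κ) : ‖restrict L ψ‖ ≤ ‖ψ‖ := by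
  refine le_of_sq_le_sq ?_ (norm_nonneg ψ)
  linarith [norm_restrict_sq_add_norm_restrict_compl_sq L ψ, sq_nonneg ‖restrict Lᶜ ψ‖]

theorem norm_restrict_sq_mono {L L' : Set κ} (h : L ⊆ L') (ψ : EuclideanSpace ℂ κ) :
    ‖restrict L ψ‖ ^ 2 ≤ ‖restrict L' ψ‖ ^ 2 := by
  classical
  rw [norm_restrict_sq, norm_restrict_sq]
  refine Finset.sum_le_sum fun l _ => ?_
  by_cases hl : l ∈ L
  · simp [hl, h hl]
  · simp only [hl, if_false]
    positivity

theorem sum_norm_restrict_preimage_sq_le (f : κ → α) (S : Finset α) (ψ : EuclideanSpace ℂ κ) :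
    ∑ a ∈ S, ‖restrict (f ⁻¹' {a}) ψ‖ ^ 2 ≤ ‖ψ‖ ^ 2 := by
  classical
  simp_rw [norm_restrict_sq, EuclideanSpace.norm_sq_eq, Set.mem_preimage, Set.mem_singleton_iff]
  rw [Finset.sum_comm]
  refine Finset.sum_le_sum fun l _ => ?_
  rw [Finset.sum_ite_eq]
  split_ifs
  · exact le_rfl
  · positivity

end Restrict

variable {ι R W : Type} [Fintype ι] [Fintype W]

theorem oracle_apply (x : ι → Bool) (ψ : StateSpace ι W) (l : BasisLabel ι W) :
    oracle x ψ l = ψ (queryFun x l) := rfl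

theorem Algorithm.norm_state (A : Algorithm ι R W) (x : ι → Bool) (T : ℕ) :
    ‖A.state x T‖ = 1 := by
  induction T with
  | zero => rw [Algorithm.state, LinearIsometryEquiv.norm_map, A.norm_init]
  | succ T ih => rw [Algorithm.state, LinearIsometryEquiv.norm_map,
      LinearIsometryEquiv.norm_map, ih]

/-- The part of a state that queries the index `i`; its squared norm is the query weight of `i` in
the hybrid argument. -/
def queryPart (i : ι) : StateSpace ι W →ₗ[ℂ] StateSpace ι W :=
  restrict (Prod.fst ⁻¹' {some i})

theorem sum_norm_queryPart_sq_le (S : Finset ι) (ψ : StateSpace ι W) :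
    ∑ i ∈ S, ‖queryPart i ψ‖ ^ 2 ≤ ‖ψ‖ ^ 2 := by
  have h := sum_norm_restrict_preimage_sq_le Prod.fst (S.map Function.Embedding.some) ψ
  rwa [Finset.sum_map] at h

theorem oracle_sub_oracle_eq_queryPart {x y : ι → Bool} {i : ι} (h : ∀ j, j ≠ i → y j = x j)
    (ψ : StateSpace ι W) :
    oracle y ψ - oracle x ψ = oracle y (queryPart i ψ) - oracle x (queryPart i ψ) := by
  ext ⟨_ | j, b, w⟩
  · simp [oracle_apply, queryFun, queryPart, restrict_apply]
  · by_cases hj : j = i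
    · simp [oracle_apply, queryFun, queryPart, restrict_apply, hj]
    · simp [oracle_apply, queryFun, h j hj]

theorem norm_oracle_sub_oracle_le {x y : ι → Bool} {i : ι} (h : ∀ j, j ≠ i → y j = x j)
    (ψ : StateSpace ι W) : ‖oracle y ψ - oracle x ψ‖ ≤ 2 * ‖queryPart i ψ‖ := by
  rw [oracle_sub_oracle_eq_queryPart h, two_mul]
  refine (norm_sub_le _ _).trans_eq ?_
  rw [LinearIsometryEquiv.norm_map, LinearIsometryEquiv.norm_map]

theorem Algorithm.norm_state_sub_le (A : Algorithm ι R W) {x y : ι → Bool} {i : ι}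
    (h : ∀ j, j ≠ i → y j = x j) (T : ℕ) :
    ‖A.state y T - A.state x T‖ ≤ ∑ t ∈ Finset.range T, 2 * ‖queryPart i (A.state x t)‖ := by
  induction T with
  | zero => simp [Algorithm.state]
  | succ T ih =>
    rw [Finset.sum_range_succ, Algorithm.state, Algorithm.state, ← map_sub,
      LinearIsometryEquiv.norm_map]
    calc ‖oracle y (A.state y T) - oracle x (A.state x T)‖
        ≤ ‖oracle y (A.state y T) - oracle y (A.state x T)‖ +
          ‖oracle y (A.state x T) - oracle x (A.state x T)‖ := norm_sub_le_norm_sub_add_norm_sub ..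
      _ ≤ _ := by
        rw [← map_sub, LinearIsometryEquiv.norm_map]
        exact add_le_add ih (norm_oracle_sub_oracle_le h _)

theorem Algorithm.sum_norm_state_sub_sq_le (A : Algorithm ι R W) (x : ι → Bool)
    (y : ι → ι → Bool) (S : Finset ι) (h : ∀ i ∈ S, ∀ j, j ≠ i → y i j = x j) (T : ℕ) :
    ∑ i ∈ S, ‖A.state (y i) T - A.state x T‖ ^ 2 ≤ 4 * (T : ℝ) ^ 2 := by
  have hstep : ∀ i ∈ S, ‖A.state (y i) T - A.state x T‖ ^ 2 ≤
      4 * T * ∑ t ∈ Finset.range T, ‖queryPart i (A.state x t)‖ ^ 2 := fun i hi => by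
    calc ‖A.state (y i) T - A.state x T‖ ^ 2
        ≤ (∑ t ∈ Finset.range T, 2 * ‖queryPart i (A.state x t)‖) ^ 2 :=
          pow_le_pow_left₀ (norm_nonneg _) (A.norm_state_sub_le (h i hi) T) 2
      _ ≤ T * ∑ t ∈ Finset.range T, (2 * ‖queryPart i (A.state x t)‖) ^ 2 := by
          simpa only [Finset.card_range] using sq_sum_le_card_mul_sum_sq (s := Finset.range T)
            (f := fun t => 2 * ‖queryPart i (A.state x t)‖)
      _ = 4 * T * ∑ t ∈ Finset.range T, ‖queryPart i (A.state x t)‖ ^ 2 := by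
          simp only [mul_pow, ← Finset.mul_sum]
          ring
  have hweight : ∀ t, ∑ i ∈ S, ‖queryPart i (A.state x t)‖ ^ 2 ≤ 1 := fun t => by
    simpa only [A.norm_state, one_pow] using sum_norm_queryPart_sq_le S (A.state x t)
  calc ∑ i ∈ S, ‖A.state (y i) T - A.state x T‖ ^ 2
      ≤ 4 * T * ∑ t ∈ Finset.range T, ∑ i ∈ S, ‖queryPart i (A.state x t)‖ ^ 2 := by
        rw [Finset.sum_comm, Finset.mul_sum]
        exact Finset.sum_le_sum hstep
    _ ≤ 4 * T * ∑ _t ∈ Finset.range T, 1 := by gcongr; exact hweight _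
    _ = 4 * (T : ℝ) ^ 2 := by
        rw [Finset.sum_const, Finset.card_range, nsmul_eq_mul]
        ring

theorem Algorithm.outputProb_eq_norm_restrict_sq (A : Algorithm ι R W) (T : ℕ) (x : ι → Bool)
    (S : Set R) : A.outputProb T x S = ‖restrict (A.out ⁻¹' S) (A.state x T)‖ ^ 2 :=
  (norm_restrict_sq _ _).symm

theorem Algorithm.outputProb_mono (A : Algorithm ι R W) (T : ℕ) (x : ι → Bool) {S S' : Set R}
    (h : S ⊆ S') : A.outputProb T x S ≤ A.outputProb T x S' := by
  simp only [outputProb_eq_norm_restrict_sq]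
  exact norm_restrict_sq_mono (Set.preimage_mono h) _

theorem Algorithm.outputProb_add_compl (A : Algorithm ι R W) (T : ℕ) (x : ι → Bool) (S : Set R) :
    A.outputProb T x S + A.outputProb T x Sᶜ = 1 := by
  rw [outputProb_eq_norm_restrict_sq, outputProb_eq_norm_restrict_sq, Set.preimage_compl,
    norm_restrict_sq_add_norm_restrict_compl_sq, A.norm_state, one_pow]

theorem Algorithm.outputProb_add_le_one (A : Algorithm ι R W) (T : ℕ) (x : ι → Bool)
    {S S' : Set R} (h : Disjoint S S') : A.outputProb T x S + A.outputProb T x S' ≤ 1 := by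
  have := A.outputProb_mono T x h.subset_compl_left
  linarith [A.outputProb_add_compl T x S]

theorem Algorithm.sqrt_outputProb_le_add (A : Algorithm ι R W) (T : ℕ) (x y : ι → Bool)
    (S : Set R) :
    √(A.outputProb T y S) ≤ √(A.outputProb T x S) + ‖A.state y T - A.state x T‖ := by
  simp only [outputProb_eq_norm_restrict_sq, Real.sqrt_sq (norm_nonneg _)]
  refine (norm_le_norm_add_norm_sub _ _).trans (add_le_add_right ?_ _)
  rw [norm_sub_rev, ← map_sub]
  exact norm_restrict_le _ _

theorem Algorithm.exists_forall_ne_outputProb_le_half [Nonempty R] (A : Algorithm ι R W) (T : ℕ)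
    (x : ι → Bool) : ∃ r₀, ∀ r, r ≠ r₀ → A.outputProb T x {r} ≤ 1 / 2 := by
  by_contra! h
  obtain ⟨a, -, ha⟩ := h (Classical.arbitrary R)
  obtain ⟨b, hba, hb⟩ := h a
  linarith [A.outputProb_add_le_one T x (Set.disjoint_singleton.2 hba)]

theorem not_computableWith_zero {f : (ι → Bool) → R → Prop} {x y : ι → Bool}
    (h : Disjoint {r | f x r} {r | f y r}) : ¬ ComputableWith f 0 := by
  rintro ⟨W, _, A, hA⟩
  have hxy : A.outputProb 0 x {r | f y r} = A.outputProb 0 y {r | f y r} := rfl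
  linarith [A.outputProb_add_le_one 0 x h, hA x, hA y]

theorem Algorithm.one_div_hundred_le_norm_state_sub_sq (A : Algorithm ι R W) {T : ℕ}
    {x y : ι → Bool} {S : Set R} (hx : A.outputProb T x S ≤ 1 / 2)
    (hy : 2 / 3 ≤ A.outputProb T y S) : 1 / 100 ≤ ‖A.state y T - A.state x T‖ ^ 2 := by
  have hx' : √(A.outputProb T x S) ≤ 71 / 100 := Real.sqrt_le_iff.2 ⟨by norm_num, by linarith⟩
  have hy' : 81 / 100 ≤ √(A.outputProb T y S) := Real.le_sqrt_of_sq_le (by linarith)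
  have := A.sqrt_outputProb_le_add T x y S
  calc (1 / 100 : ℝ) = (1 / 10) ^ 2 := by norm_num
    _ ≤ _ := pow_le_pow_left₀ (by norm_num) (by linarith) 2

theorem ComputableWith.exists_card_filter_ne_le [DecidableEq R] [Nonempty R]
    {f : (ι → Bool) → R → Prop} {T : ℕ} (hf : ComputableWith f T) (x : ι → Bool)
    (y : ι → ι → Bool) (S : Finset ι) (r : ι → R) (hy : ∀ i ∈ S, ∀ j, j ≠ i → y i j = x j)
    (hr : ∀ i ∈ S, ∀ s, f (y i) s → s = r i) :
    ∃ r₀ : R, (S.filter fun i => r i ≠ r₀).card ≤ 400 * T ^ 2 := by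
  obtain ⟨W, _, A, hA⟩ := hf
  obtain ⟨r₀, hr₀⟩ := A.exists_forall_ne_outputProb_le_half T x
  refine ⟨r₀, ?_⟩
  have hfar : ∀ i ∈ S.filter (fun i => r i ≠ r₀),
      (1 / 100 : ℝ) ≤ ‖A.state (y i) T - A.state x T‖ ^ 2 := fun i hi => by
    obtain ⟨hi, hne⟩ := Finset.mem_filter.1 hi
    exact A.one_div_hundred_le_norm_state_sub_sq (hr₀ _ hne)
      ((hA (y i)).trans (A.outputProb_mono T (y i) (hr i hi)))
  have hsum := (Finset.card_nsmul_le_sum _ _ _ hfar).trans (A.sum_norm_state_sub_sq_le x y _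
    (fun i hi => hy i (Finset.mem_filter.1 hi).1) T)
  rw [nsmul_eq_mul] at hsum
  have : ((S.filter fun i => r i ≠ r₀).card : ℝ) ≤ 400 * T ^ 2 := by linarith
  exact_mod_cast this

theorem Q_le {f : (ι → Bool) → R → Prop} {T : ℕ} (h : ComputableWith f T) :
    (Q f : ℝ≥0∞) ≤ T := by
  rw [← ENat.toENNReal_coe, ENat.toENNReal_le]
  exact iInf₂_le T h

theorem le_Q {f : (ι → Bool) → R → Prop} {a : ℝ≥0∞} (h : ∀ T, ComputableWith f T → a ≤ T) :
    a ≤ (Q f : ℝ≥0∞) := by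
  simp only [Q, ENat.toENNReal_iInf, ENat.toENNReal_coe]
  exact le_iInf₂ h

end QuantumQuery

namespace Tournament

open QuantumQuery (ComputableWith not_computableWith_zero)

variable {n : ℕ}

/-- The vertex that the edge `e` leaves in the tournament `T`. -/
def tail (T : Edge n → Bool) (e : Edge n) : Fin n := if T e then e.1.1 else e.1.2

/-- The vertex that the edge `e` enters in the tournament `T`. -/
def head (T : Edge n → Bool) (e : Edge n) : Fin n := if T e then e.1.2 else e.1.1

/-- The tournament obtained from `T` by reversing the edge `e`. -/
def reverse (T : Edge n → Bool) (e : Edge n) : Edge n → Bool := Function.update T e (!T e)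

theorem arc_iff_exists_tail_head (T : Edge n → Bool) (u v : Fin n) :
    Arc T u v ↔ ∃ e, tail T e = u ∧ head T e = v := by
  constructor
  · rintro (⟨h, hT⟩ | ⟨h, hT⟩)
    · exact ⟨⟨(u, v), h⟩, by simp [tail, hT], by simp [head, hT]⟩
    · exact ⟨⟨(v, u), h⟩, by simp [tail, hT], by simp [head, hT]⟩
  · rintro ⟨e, rfl, rfl⟩
    cases hT : T e
    · exact Or.inr (by simpa [tail, head, hT] using e.2)
    · exact Or.inl (by simpa [tail, head, hT] using e.2)

theorem edge_eq_of_tail_eq_of_head_eq (T : Edge n → Bool) {e e' : Edge n}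
    (ht : tail T e = tail T e') (hh : head T e = head T e') : e = e' := by
  have h := e.2
  have h' := e'.2
  unfold tail head at *
  split_ifs at ht hh
  · exact Subtype.ext (Prod.ext ht hh)
  · exact absurd h (by rw [ht, hh]; exact h'.not_gt)
  · exact absurd h (by rw [ht, hh]; exact h'.not_gt)
  · exact Subtype.ext (Prod.ext hh ht)

theorem outDegree_eq_card_tail (T : Edge n → Bool) (v : Fin n) :
    outDegree T v = (Finset.univ.filter fun e => tail T e = v).card := by
  classical
  rw [outDegree]
  refine (Finset.card_nbij (head T) ?_ ?_ ?_).symm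
  · exact fun e he => by
      simpa using (arc_iff_exists_tail_head T v _).2 ⟨e, by simpa using he, rfl⟩
  · intro e he e' he' h
    refine edge_eq_of_tail_eq_of_head_eq T ?_ h
    simp_all
  · intro u hu
    obtain ⟨e, he, rfl⟩ := (arc_iff_exists_tail_head T v u).1 (by simpa using hu)
    exact ⟨e, by simpa using he, rfl⟩

theorem tail_reverse_self (T : Edge n → Bool) (e : Edge n) : tail (reverse T e) e = head T e := by
  cases h : T e <;> simp [tail, head, reverse, h]

theorem tail_reverse_of_ne (T : Edge n → Bool) {e e' : Edge n} (h : e' ≠ e) :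
    tail (reverse T e) e' = tail T e' := by
  simp [tail, reverse, h]

theorem tail_ne_head (T : Edge n → Bool) (e : Edge n) : tail T e ≠ head T e := by
  unfold tail head
  split_ifs
  exacts [e.2.ne, e.2.ne']

theorem outDegree_reverse_head (T : Edge n → Bool) (e : Edge n) :
    outDegree (reverse T e) (head T e) = outDegree T (head T e) + 1 := by
  classical
  rw [outDegree_eq_card_tail, outDegree_eq_card_tail, ← Finset.card_insert_of_notMem (a := e)]
  · congr 1
    ext e'
    by_cases h : e' = e
    · simp [h, tail_reverse_self]
    · simp [h, tail_reverse_of_ne]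
  · simp [tail_ne_head]

theorem outDegree_reverse_le (T : Edge n → Bool) {e : Edge n} {v : Fin n} (hv : v ≠ head T e) :
    outDegree (reverse T e) v ≤ outDegree T v := by
  rw [outDegree_eq_card_tail, outDegree_eq_card_tail]
  refine Finset.card_le_card fun e' he' => ?_
  simp only [Finset.mem_filter, Finset.mem_univ, true_and] at he' ⊢
  obtain rfl | h := eq_or_ne e' e
  · exact absurd (he'.symm.trans (tail_reverse_self T e')) hv
  · rwa [tail_reverse_of_ne T h] at he'

theorem eq_head_of_MOD_reverse {T : Edge n → Bool} {e : Edge n} {w : Fin n}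
    (he : MOD n T (head T e)) (hw : MOD n (reverse T e) w) : w = head T e := by
  by_contra h
  have := hw (head T e)
  have := outDegree_reverse_le T h
  have := outDegree_reverse_head T e
  have := he w
  omega

theorem choose_two_le_card_filter_edge (M : Finset (Fin n)) :
    M.card.choose 2 ≤
      (Finset.univ.filter fun e : Edge n => e.1.1 ∈ M ∧ e.1.2 ∈ M).card := by
  rw [← Sym2.card_image_offDiag]
  refine (Finset.card_le_card fun z hz => ?_).trans
    (Finset.card_image_le (f := fun e : Edge n => s(e.1.1, e.1.2)))
  obtain ⟨⟨u, v⟩, huv, rfl⟩ := Finset.mem_image.1 hz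
  obtain ⟨hu, hv, hne⟩ := Finset.mem_offDiag.1 huv
  rcases lt_or_gt_of_ne hne with h | h
  · exact Finset.mem_image.2 ⟨⟨(u, v), h⟩, by simp_all, rfl⟩
  · exact Finset.mem_image.2 ⟨⟨(v, u), h⟩, by simp_all, Sym2.eq_swap⟩

theorem choose_two_le_of_computableWith_MOD {t : ℕ} (ht : ComputableWith (MOD n) t)
    (T : Edge n → Bool) (M : Finset (Fin n)) (hM : ∀ v ∈ M, MOD n T v) :
    (M.card - 1).choose 2 ≤ 400 * t ^ 2 := by
  obtain rfl | ⟨v, -⟩ := M.eq_empty_or_nonempty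
  · simp
  have : Nonempty (Fin n) := ⟨v⟩
  obtain ⟨r₀, hr₀⟩ := ht.exists_card_filter_ne_le T (reverse T)
    (Finset.univ.filter fun e => head T e ∈ M) (head T)
    (fun _ _ _ h => Function.update_of_ne h _ _)
    (fun e he _ => eq_head_of_MOD_reverse (hM _ (Finset.mem_filter.1 he).2))
  calc (M.card - 1).choose 2 ≤ (M.erase r₀).card.choose 2 :=
        Nat.choose_le_choose 2 Finset.pred_card_le_card_erase
    _ ≤ _ := choose_two_le_card_filter_edge _
    _ ≤ _ := Finset.card_le_card fun e he => by
        simp only [Finset.mem_filter, Finset.mem_univ, true_and, Finset.mem_erase] at he ⊢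
        unfold head
        split_ifs
        exacts [⟨he.2.2, he.2.1⟩, ⟨he.1.2, he.1.1⟩]
    _ ≤ 400 * t ^ 2 := hr₀

/-- The almost regular tournament in which, for `i < j`, the edge is directed `i → j` if and only
if `j - i ≤ (n - 1) / 2`. -/
def cyclic (n : ℕ) (e : Edge n) : Bool := decide ((e.1.2 : ℕ) - e.1.1 ≤ (n - 1) / 2)

theorem arc_cyclic_iff (w u : Fin n) :
    Arc (cyclic n) w u ↔ ((w : ℕ) < u ∧ (u : ℕ) - w ≤ (n - 1) / 2) ∨
      (u : ℕ) < w - (n - 1) / 2 := by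
  simp only [Arc, cyclic, Fin.lt_def, decide_eq_true_eq, decide_eq_false_iff_not, exists_prop]
  omega

theorem outDegree_cyclic (w : Fin n) :
    outDegree (cyclic n) w = min ((n - 1) / 2) (n - 1 - w) + (w - (n - 1) / 2) := by
  classical
  have himage : (Finset.univ.filter fun u => Arc (cyclic n) w u).map Fin.valEmbedding =
      Finset.Ioc (w : ℕ) (min (w + (n - 1) / 2) (n - 1)) ∪ Finset.range (w - (n - 1) / 2) := by
    ext a
    simp only [Finset.mem_map, Finset.mem_filter, Finset.mem_univ, true_and, arc_cyclic_iff,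
      Fin.valEmbedding_apply, Finset.mem_union, Finset.mem_Ioc, Finset.mem_range]
    constructor
    · rintro ⟨u, hu, rfl⟩
      omega
    · intro ha
      exact ⟨⟨a, by omega⟩, by simp only; omega, rfl⟩
  have hdisj : Disjoint (Finset.Ioc (w : ℕ) (min (w + (n - 1) / 2) (n - 1)))
      (Finset.range (w - (n - 1) / 2)) :=
    Finset.disjoint_left.2 fun a ha ha' => by
      simp only [Finset.mem_Ioc, Finset.mem_range] at ha ha'
      omega
  rw [outDegree, ← Finset.card_map Fin.valEmbedding, himage, Finset.card_union_of_disjoint hdisj,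
    Nat.card_Ioc, Finset.card_range]
  omega

theorem MOD_cyclic {v : Fin n} (hv : (n - 1) / 2 < v) : MOD n (cyclic n) v := fun w => by
  rw [outDegree_cyclic, outDegree_cyclic]
  omega

theorem outDegree_const_true (v : Fin n) : outDegree (fun _ => true) v = n - 1 - v := by
  rw [outDegree, ← Fin.card_Ioi]
  congr 1
  ext u
  simp [Arc]

theorem outDegree_const_false (v : Fin n) : outDegree (fun _ => false) v = v := by
  rw [outDegree, ← Fin.card_Iio v]
  congr 1
  ext u
  simp [Arc]

theorem not_computableWith_MOD_zero (hn : 2 ≤ n) : ¬ ComputableWith (MOD n) 0 := by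
  refine not_computableWith_zero (x := fun _ => true) (y := fun _ => false)
    (Set.disjoint_left.2 fun v hx hy => ?_)
  have hfirst := hx ⟨0, by omega⟩
  have hlast := hy ⟨n - 1, by omega⟩
  simp only [outDegree_const_true, outDegree_const_false] at hfirst hlast
  omega

theorem le_mul_of_computableWith_MOD (hn : 2 ≤ n) {t : ℕ} (ht : ComputableWith (MOD n) t) :
    n ≤ 64 * t := by
  have ht₀ : 1 ≤ t := Nat.one_le_iff_ne_zero.2 fun h =>
    not_computableWith_MOD_zero hn (h ▸ ht)
  by_contra! hlt
  have hquad := choose_two_le_of_computableWith_MOD ht (cyclic n)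
    (Finset.Ioi ⟨(n - 1) / 2, by omega⟩) fun v hv =>
      MOD_cyclic (Fin.lt_def.1 (Finset.mem_Ioi.1 hv))
  rw [Fin.card_Ioi, Nat.choose_two_right] at hquad
  have hlarge : (30 * t) * (30 * t) ≤
      (n - 1 - (n - 1) / 2 - 1) * (n - 1 - (n - 1) / 2 - 1 - 1) :=
    Nat.mul_le_mul (by omega) (by omega)
  have hsq : 1 ≤ t ^ 2 := Nat.one_le_pow 2 t ht₀
  have : (30 * t) * (30 * t) = 900 * t ^ 2 := by ring
  simp only at hquad
  omega

end Tournament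

namespace QuantumQuery

section Implements

variable {ι R W : Type} [Fintype ι] [Fintype W]

/-- `Implements T V`: the unitary `V x` is of the form `U_T O_x U_{T-1} O_x ⋯ O_x U_0`, with
unitaries `U_j` that do not depend on `x`. -/
inductive Implements : ℕ → ((ι → Bool) → StateSpace ι W ≃ₗᵢ[ℂ] StateSpace ι W) → Prop
  | const (U : StateSpace ι W ≃ₗᵢ[ℂ] StateSpace ι W) : Implements 0 fun _ => U
  | query {T : ℕ} {V : (ι → Bool) → StateSpace ι W ≃ₗᵢ[ℂ] StateSpace ι W}
      (U : StateSpace ι W ≃ₗᵢ[ℂ] StateSpace ι W) (hV : Implements T V) :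
      Implements (T + 1) fun x => U * oracle x * V x

variable {T T₁ T₂ : ℕ} {V V₁ V₂ : (ι → Bool) → StateSpace ι W ≃ₗᵢ[ℂ] StateSpace ι W}

theorem implements_oracle : Implements 1 (oracle (ι := ι) (W := W)) := by
  simpa only [one_mul, mul_one] using Implements.query (ι := ι) (W := W) 1 (.const 1)

theorem Implements.exists_eq_const (h : Implements 0 V) : ∃ U, V = fun _ => U := by
  cases h with
  | const U => exact ⟨U, rfl⟩

theorem Implements.exists_eq_query (h : Implements (T + 1) V) :
    ∃ U V', Implements T V' ∧ V = fun x => U * oracle x * V' x := by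
  cases h with
  | query U hV => exact ⟨U, _, hV, rfl⟩

theorem Implements.const_mul (U : StateSpace ι W ≃ₗᵢ[ℂ] StateSpace ι W) (h : Implements T V) :
    Implements T fun x => U * V x := by
  cases h with
  | const U' => exact .const (U * U')
  | query U' hV => simpa only [mul_assoc] using Implements.query (U * U') hV

theorem Implements.mul (h₁ : Implements T₁ V₁) (h₂ : Implements T₂ V₂) :
    Implements (T₂ + T₁) (V₁ * V₂) := by
  induction h₁ with
  | const U => exact h₂.const_mul U
  | query U _ ih => simpa only [Pi.mul_def, mul_assoc, add_assoc] using Implements.query U ih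

theorem oracle_inv (x : ι → Bool) : (oracle (W := W) x)⁻¹ = oracle x := by
  refine inv_eq_of_mul_eq_one_left (LinearIsometryEquiv.ext fun ψ => ?_)
  ext l
  exact congrArg ψ (queryFun_involutive x l)

theorem Implements.inv (h : Implements T V) : Implements T V⁻¹ := by
  induction h with
  | const U => exact .const U⁻¹
  | @query T V U _ ih =>
    have hinv := ih.mul (implements_oracle.mul (.const U⁻¹))
    convert hinv using 1
    · omega
    · funext x
      simp only [Pi.inv_apply, Pi.mul_apply, mul_inv_rev, oracle_inv]

theorem Implements.pow (h : Implements T V) (k : ℕ) : Implements (k * T) (V ^ k) := by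
  induction k with
  | zero => rw [zero_mul, pow_zero]; exact .const 1
  | succ k ih => simpa only [Nat.succ_mul, pow_succ', add_comm T] using h.mul ih

theorem Algorithm.state_congr {A B : Algorithm ι R W} (hinit : A.init = B.init)
    (hU : ∀ t ≤ T, A.U t = B.U t) (x : ι → Bool) : A.state x T = B.state x T := by
  induction T with
  | zero => rw [state, state, hinit, hU 0 le_rfl]
  | succ T ih => rw [state, state, hU (T + 1) le_rfl, ih fun t ht => hU t (by omega)]

theorem Implements.exists_algorithm (h : Implements T V) (φ : StateSpace ι W) (hφ : ‖φ‖ = 1)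
    (out : BasisLabel ι W → R) :
    ∃ A : Algorithm ι R W, A.init = φ ∧ A.out = out ∧ ∀ x, A.state x T = V x φ := by
  induction h with
  | const U => exact ⟨⟨φ, hφ, fun _ => U, out⟩, rfl, rfl, fun _ => rfl⟩
  | @query T V U _ ih =>
    obtain ⟨A, rfl, rfl, hA⟩ := ih
    let B : Algorithm ι R W := { A with U := Function.update A.U (T + 1) U }
    have hBA : ∀ x, B.state x T = A.state x T := Algorithm.state_congr rfl fun t ht =>
      Function.update_of_ne (by omega) _ _
    refine ⟨B, rfl, rfl, fun x => ?_⟩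
    rw [Algorithm.state, hBA, hA, show B.U (T + 1) = U from Function.update_self ..]
    rfl

end Implements

section Control

variable {ι W W' C : Type} [Fintype ι] [Fintype W] [Fintype W'] [Fintype C]

/-- The labels of the basis with workspace `W' ≃ W × C`, grouped by their control value in `C`. -/
def controlEquiv (e : W' ≃ W × C) : BasisLabel ι W' ≃ (_ : C) × BasisLabel ι W where
  toFun l := ⟨(e l.2.2).2, l.1, l.2.1, (e l.2.2).1⟩
  invFun p := (p.2.1, p.2.2.1, e.symm (p.2.2.2, p.1))
  left_inv l := by simp
  right_inv p := by simp

/-- The unitary that applies `U c` if the control register holds `c`. -/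
def control (e : W' ≃ W × C) (U : C → StateSpace ι W ≃ₗᵢ[ℂ] StateSpace ι W) :
    StateSpace ι W' ≃ₗᵢ[ℂ] StateSpace ι W' :=
  (LinearIsometryEquiv.piLpCongrLeft 2 ℂ ℂ (controlEquiv e)).trans <|
    (LinearIsometryEquiv.piLpCurry ℂ 2 fun _ _ => ℂ).trans <|
    (LinearIsometryEquiv.piLpCongrRight 2 U).trans <|
    (LinearIsometryEquiv.piLpCurry ℂ 2 fun _ _ => ℂ).symm.trans
    (LinearIsometryEquiv.piLpCongrLeft 2 ℂ ℂ (controlEquiv e).symm)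

theorem control_apply (e : W' ≃ W × C) (U : C → StateSpace ι W ≃ₗᵢ[ℂ] StateSpace ι W)
    (ψ : StateSpace ι W') (i : Option ι) (b : Bool) (w : W') :
    control e U ψ (i, b, w) = U (e w).2
      (WithLp.toLp 2 fun l : BasisLabel ι W => ψ (l.1, l.2.1, e.symm (l.2.2, (e w).2)))
      (i, b, (e w).1) := rfl

theorem control_oracle (e : W' ≃ W × C) (x : ι → Bool) :
    control e (fun _ => oracle x) = oracle x := by
  ext ψ ⟨i, b, w⟩
  rw [control_apply]
  cases i <;> simp [oracle_apply, queryFun]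

theorem control_mul (e : W' ≃ W × C) (U V : C → StateSpace ι W ≃ₗᵢ[ℂ] StateSpace ι W) :
    control e (U * V) = control e U * control e V := by
  ext ψ ⟨i, b, w⟩
  simp [control_apply]

theorem Implements.control {T : ℕ} (e : W' ≃ W × C)
    {V : C → (ι → Bool) → StateSpace ι W ≃ₗᵢ[ℂ] StateSpace ι W} (h : ∀ c, Implements T (V c)) :
    Implements T fun x => QuantumQuery.control e fun c => V c x := by
  induction T generalizing V with
  | zero =>
    choose U hU using fun c => (h c).exists_eq_const
    simpa only [hU] using Implements.const (QuantumQuery.control e U)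
  | succ T ih =>
    choose U V' hV' hV using fun c => (h c).exists_eq_query
    convert Implements.query (QuantumQuery.control e U) (ih hV') using 2 with x
    rw [← control_oracle e, ← control_mul, ← control_mul]
    simp only [hV, Pi.mul_def]

end Control

section Born

variable {κ κ₁ κ₂ : Type*} [Fintype κ] [Fintype κ₁] [Fintype κ₂]

/-- The distribution of the outcome when the unit vector `ψ` is measured in the computational
basis. -/
def born (ψ : EuclideanSpace ℂ κ) (hψ : ‖ψ‖ = 1) : PMF κ :=
  PMF.ofFintype (fun l => ENNReal.ofReal (‖ψ l‖ ^ 2)) <| by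
    rw [← ENNReal.ofReal_sum_of_nonneg fun _ _ => sq_nonneg _, ← EuclideanSpace.norm_sq_eq, hψ,
      one_pow, ENNReal.ofReal_one]

theorem born_apply (ψ : EuclideanSpace ℂ κ) (hψ : ‖ψ‖ = 1) (l : κ) :
    born ψ hψ l = ENNReal.ofReal (‖ψ l‖ ^ 2) := rfl

theorem toOuterMeasure_born (ψ : EuclideanSpace ℂ κ) (hψ : ‖ψ‖ = 1) (L : Set κ) :
    (born ψ hψ).toOuterMeasure L = ENNReal.ofReal (‖restrict L ψ‖ ^ 2) := by
  classical
  rw [PMF.toOuterMeasure_apply_fintype, norm_restrict_sq, ENNReal.ofReal_sum_of_nonneg]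
  · refine Finset.sum_congr rfl fun l _ => ?_
    by_cases hl : l ∈ L <;> simp [hl, born_apply]
  · intro l _
    split_ifs <;> positivity

theorem map_born_eq_bind (e : κ ≃ κ₁ × κ₂) {Ψ : EuclideanSpace ℂ κ} {ψ₁ : EuclideanSpace ℂ κ₁}
    {ψ₂ : κ₁ → EuclideanSpace ℂ κ₂} (hΨ : ‖Ψ‖ = 1) (h₁ : ‖ψ₁‖ = 1) (h₂ : ∀ l, ‖ψ₂ l‖ = 1)
    (h : ∀ l₁ l₂, Ψ (e.symm (l₁, l₂)) = ψ₁ l₁ * ψ₂ l₁ l₂) :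
    (born Ψ hΨ).map e = (born ψ₁ h₁).bind fun l₁ => (born (ψ₂ l₁) (h₂ l₁)).map (Prod.mk l₁) := by
  classical
  ext ⟨l₁, l₂⟩
  rw [PMF.map_apply, tsum_eq_single (e.symm (l₁, l₂)), PMF.bind_apply, tsum_eq_single l₁,
    PMF.map_apply, tsum_eq_single l₂]
  · simp [born_apply, h, mul_pow, ENNReal.ofReal_mul]
  · exact fun l hl => if_neg fun heq => hl (Prod.mk.inj heq).2.symm
  · intro l hl
    rw [PMF.map_apply, ENNReal.tsum_eq_zero.2, mul_zero]
    exact fun l' => if_neg fun heq => hl (Prod.mk.inj heq).1.symm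
  · exact fun l hl => if_neg fun heq => hl (by rw [heq, Equiv.symm_apply_apply])

end Born

/-- The unitary that permutes the computational basis by `σ`. -/
def permute {κ : Type*} [Fintype κ] (σ : Equiv.Perm κ) :
    EuclideanSpace ℂ κ ≃ₗᵢ[ℂ] EuclideanSpace ℂ κ :=
  LinearIsometryEquiv.piLpCongrLeft 2 ℂ ℂ σ

theorem permute_mul {κ : Type*} [Fintype κ] (σ τ : Equiv.Perm κ) :
    permute (σ * τ) = permute σ * permute τ := by
  ext ψ l
  rfl

section Sequential

variable {ι W₁ W₂ : Type} [Fintype ι] [Fintype W₁] [Fintype W₂]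

/-- The basis labels of a pair of registers. Only one of them can use the query index and the query
bit; those of the other one are stored in the workspace. -/
def pairEquiv (ι W₁ W₂ : Type) :
    BasisLabel ι (W₁ × BasisLabel ι W₂) ≃ BasisLabel ι W₁ × BasisLabel ι W₂ where
  toFun l := ((l.1, l.2.1, l.2.2.1), l.2.2.2)
  invFun p := (p.1.1, p.1.2.1, p.1.2.2, p.2)
  left_inv _ := rfl
  right_inv _ := rfl

/-- The exchange of the query index and the query bit with those stored in the workspace. -/
def swapQuery (ι W₁ W₂ : Type) : Equiv.Perm (BasisLabel ι (W₁ × BasisLabel ι W₂)) where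
  toFun l := (l.2.2.2.1, l.2.2.2.2.1, l.2.2.1, l.1, l.2.1, l.2.2.2.2.2)
  invFun l := (l.2.2.2.1, l.2.2.2.2.1, l.2.2.1, l.1, l.2.1, l.2.2.2.2.2)
  left_inv _ := rfl
  right_inv _ := rfl

/-- The splitting of the workspace of a pair of registers by which the second register is
controlled by the first one. -/
def workspaceEquiv (ι W₁ W₂ : Type) : W₁ × BasisLabel ι W₂ ≃ W₂ × BasisLabel ι W₁ where
  toFun p := (p.2.2.2, p.2.1, p.2.2.1, p.1)
  invFun p := (p.2.2.2, p.2.1, p.2.2.1, p.1)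
  left_inv _ := rfl
  right_inv _ := rfl

/-- The product state of two registers. -/
def tensor (φ₁ : StateSpace ι W₁) (φ₂ : StateSpace ι W₂) :
    StateSpace ι (W₁ × BasisLabel ι W₂) :=
  WithLp.toLp 2 fun l => φ₁ (l.1, l.2.1, l.2.2.1) * φ₂ l.2.2.2

/-- The unitary that applies `U₁` to the first register and then, controlled by the basis label
`l` of the first register, `U₂ l` to the second one. -/
def sequential (U₁ : StateSpace ι W₁ ≃ₗᵢ[ℂ] StateSpace ι W₁)
    (U₂ : BasisLabel ι W₁ → StateSpace ι W₂ ≃ₗᵢ[ℂ] StateSpace ι W₂) :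
    StateSpace ι (W₁ × BasisLabel ι W₂) ≃ₗᵢ[ℂ] StateSpace ι (W₁ × BasisLabel ι W₂) :=
  control (workspaceEquiv ι W₁ W₂) U₂ * permute (swapQuery ι W₁ W₂) *
    control (.refl _) fun _ => U₁

theorem norm_tensor (φ₁ : StateSpace ι W₁) (φ₂ : StateSpace ι W₂) :
    ‖tensor φ₁ φ₂‖ = ‖φ₁‖ * ‖φ₂‖ := by
  rw [← sq_eq_sq₀ (norm_nonneg _) (by positivity), mul_pow, EuclideanSpace.norm_sq_eq,
    EuclideanSpace.norm_sq_eq φ₁, EuclideanSpace.norm_sq_eq φ₂, Fintype.sum_mul_sum,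
    ← Fintype.sum_prod_type', ← Equiv.sum_comp (pairEquiv ι W₁ W₂)]
  exact Finset.sum_congr rfl fun l _ => by rw [← mul_pow, ← norm_mul]; rfl

theorem control_tensor (U : StateSpace ι W₁ ≃ₗᵢ[ℂ] StateSpace ι W₁) (φ₁ : StateSpace ι W₁)
    (φ₂ : StateSpace ι W₂) :
    control (.refl _) (fun _ => U) (tensor φ₁ φ₂) = tensor (U φ₁) φ₂ := by
  ext ⟨i, b, w, l⟩
  change U (WithLp.toLp 2 fun l' => φ₁ l' * φ₂ l) (i, b, w) = U φ₁ (i, b, w) * φ₂ l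
  rw [show WithLp.toLp 2 (fun l' => φ₁ l' * φ₂ l) = φ₂ l • φ₁ by ext; simp [mul_comm], map_smul,
    PiLp.smul_apply, smul_eq_mul, mul_comm]

theorem sequential_tensor_apply (U₁ : StateSpace ι W₁ ≃ₗᵢ[ℂ] StateSpace ι W₁)
    (U₂ : BasisLabel ι W₁ → StateSpace ι W₂ ≃ₗᵢ[ℂ] StateSpace ι W₂) (φ₁ : StateSpace ι W₁)
    (φ₂ : StateSpace ι W₂) (l₁ : BasisLabel ι W₁) (l₂ : BasisLabel ι W₂) :
    sequential U₁ U₂ (tensor φ₁ φ₂) (swapQuery ι W₁ W₂ ((pairEquiv ι W₁ W₂).symm (l₁, l₂))) =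
      U₁ φ₁ l₁ * U₂ l₁ φ₂ l₂ := by
  change U₂ l₁ (WithLp.toLp 2 fun l =>
    control (.refl _) (fun _ => U₁) (tensor φ₁ φ₂) ((pairEquiv ι W₁ W₂).symm (l₁, l))) l₂ = _
  rw [control_tensor, show (WithLp.toLp 2 fun l =>
    tensor (U₁ φ₁) φ₂ ((pairEquiv ι W₁ W₂).symm (l₁, l))) = U₁ φ₁ l₁ • φ₂ by ext; rfl, map_smul,
    PiLp.smul_apply, smul_eq_mul]

theorem implements_sequential {T₁ T₂ : ℕ}
    {V₁ : (ι → Bool) → StateSpace ι W₁ ≃ₗᵢ[ℂ] StateSpace ι W₁}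
    {V₂ : BasisLabel ι W₁ → (ι → Bool) → StateSpace ι W₂ ≃ₗᵢ[ℂ] StateSpace ι W₂}
    (h₁ : Implements T₁ V₁) (h₂ : ∀ l, Implements T₂ (V₂ l)) :
    Implements (T₁ + T₂) fun x => sequential (V₁ x) fun l => V₂ l x := by
  have hmul := ((Implements.control (workspaceEquiv ι W₁ W₂) h₂).mul
    (.const (permute (swapQuery ι W₁ W₂)))).mul
    (Implements.control (.refl (W₁ × BasisLabel ι W₂)) fun _ => h₁)
  rwa [zero_add] at hmul

end Sequential

section Realizes

variable {ι : Type} [Fintype ι] {S R R' : Type*} {T T₁ T₂ : ℕ}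

/-- `Realizes T K`: the distributions `K x s`, which depend on the input `x` and on a parameter
`s`, are produced by `T`-query algorithms with a workspace and an initial state that do not depend
on `s`. -/
def Realizes (T : ℕ) (K : (ι → Bool) → S → PMF R) : Prop :=
  ∃ (W : Type) (_ : Fintype W) (φ : StateSpace ι W) (hφ : ‖φ‖ = 1)
    (V : S → (ι → Bool) → StateSpace ι W ≃ₗᵢ[ℂ] StateSpace ι W) (out : S → BasisLabel ι W → R),
    (∀ s, Implements T (V s)) ∧
      ∀ x s, K x s = (born (V s x φ) (((V s x).norm_map φ).trans hφ)).map (out s)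

theorem realizes_pure : Realizes 0 fun (_ : ι → Bool) => (PMF.pure : S → PMF S) := by
  classical
  refine ⟨Unit, inferInstance, EuclideanSpace.single (none, false, ()) 1, by simp,
    fun _ _ => 1, fun s _ => s, fun _ => .const 1, fun x s => ?_⟩
  exact (PMF.map_const _ s).symm

theorem Realizes.bind {K₁ : (ι → Bool) → S → PMF R} {K₂ : (ι → Bool) → R → PMF R'}
    (h₁ : Realizes T₁ K₁) (h₂ : Realizes T₂ K₂) :
    Realizes (T₁ + T₂) fun x s => (K₁ x s).bind (K₂ x) := by
  obtain ⟨W₁, _, φ₁, hφ₁, V₁, out₁, hV₁, hK₁⟩ := h₁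
  obtain ⟨W₂, _, φ₂, hφ₂, V₂, out₂, hV₂, hK₂⟩ := h₂
  let e := (swapQuery ι W₁ W₂).symm.trans (pairEquiv ι W₁ W₂)
  refine ⟨W₁ × BasisLabel ι W₂, inferInstance, tensor φ₁ φ₂,
    by rw [norm_tensor, hφ₁, hφ₂, one_mul],
    fun s x => sequential (V₁ s x) fun l => V₂ (out₁ s l) x,
    fun s l => out₂ (out₁ s (e l).1) (e l).2,
    fun s => implements_sequential (hV₁ s) fun l => hV₂ (out₁ s l), fun x s => ?_⟩
  have hborn := map_born_eq_bind e ((LinearIsometryEquiv.norm_map _ _).trans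
      (by rw [norm_tensor, hφ₁, hφ₂, one_mul])) (((V₁ s x).norm_map φ₁).trans hφ₁)
    (fun l => ((V₂ (out₁ s l) x).norm_map φ₂).trans hφ₂)
    (sequential_tensor_apply (V₁ s x) (fun l => V₂ (out₁ s l) x) φ₁ φ₂)
  have hmap := congrArg (PMF.map fun p => out₂ (out₁ s p.1) p.2) hborn
  rw [PMF.map_comp, PMF.map_bind] at hmap
  simp only [PMF.map_comp] at hmap
  refine Eq.trans ?_ hmap.symm
  simp only [hK₁, PMF.bind_map]
  exact congrArg _ (funext fun l => hK₂ x (out₁ s l))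

theorem Realizes.map {K : (ι → Bool) → S → PMF R} (h : Realizes T K) (g : S → R → R') :
    Realizes T fun x s => (K x s).map (g s) := by
  obtain ⟨W, _, φ, hφ, V, out, hV, hK⟩ := h
  exact ⟨W, inferInstance, φ, hφ, V, fun s => g s ∘ out s, hV, fun x s => by
    simp only [hK, PMF.map_comp]⟩

/-- The `r`-fold iteration of a Markov kernel. -/
def iterKernel (K : S → PMF S) : ℕ → S → PMF S
  | 0 => PMF.pure
  | r + 1 => fun s => (K s).bind (iterKernel K r)

theorem Realizes.iterKernel {K : (ι → Bool) → S → PMF S} (h : Realizes T K) (r : ℕ) :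
    Realizes (r * T) fun x => QuantumQuery.iterKernel (K x) r := by
  induction r with
  | zero => rw [zero_mul]; exact realizes_pure
  | succ r ih => rw [Nat.succ_mul, add_comm]; exact h.bind ih

theorem Realizes.computableWith {R R' : Type} {K : (ι → Bool) → S → PMF R} (h : Realizes T K)
    (s : S) (p : R → R') {f : (ι → Bool) → R' → Prop}
    (hf : ∀ x, (K x s).toOuterMeasure {r | ¬ f x (p r)} ≤ 1 / 3) : ComputableWith f T := by
  obtain ⟨W, _, φ, hφ, V, out, hV, hK⟩ := h
  obtain ⟨A, -, hout, hA⟩ := (hV s).exists_algorithm φ hφ fun l => p (out s l)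
  refine ⟨W, inferInstance, A, fun x => ?_⟩
  have hfail : A.outputProb T x {r | f x r}ᶜ ≤ 1 / 3 := by
    have hfx := hf x
    rw [hK, PMF.toOuterMeasure_map_apply, toOuterMeasure_born] at hfx
    rw [A.outputProb_eq_norm_restrict_sq, hout, hA]
    refine (ENNReal.ofReal_le_ofReal_iff (by norm_num)).1 (hfx.trans_eq ?_)
    rw [ENNReal.ofReal_div_of_pos (by norm_num), ENNReal.ofReal_one, ENNReal.ofReal_ofNat]
  linarith [A.outputProb_add_compl T x {r | f x r}]

end Realizes

section Grover

variable {𝕜 E : Type*} [RCLike 𝕜] [NormedAddCommGroup E] [InnerProductSpace 𝕜 E]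

/-- The unit vector at angle `φ` from the direction of `b` towards that of `g`, in the plane
spanned by two orthogonal vectors. -/
def planeVector (𝕜 : Type*) {E : Type*} [RCLike 𝕜] [NormedAddCommGroup E] [InnerProductSpace 𝕜 E]
    (g b : E) (φ : ℝ) : E :=
  ((Real.sin φ / ‖g‖ : ℝ) : 𝕜) • g + ((Real.cos φ / ‖b‖ : ℝ) : 𝕜) • b

theorem ofReal_smul_eq_smul {r s : ℝ} {v : E} (h : r * ‖v‖ = s * ‖v‖) :
    (r : 𝕜) • v = (s : 𝕜) • v := by
  rcases eq_or_ne v 0 with rfl | hv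
  · rw [smul_zero, smul_zero]
  · rw [mul_right_cancel₀ (norm_ne_zero_iff.2 hv) h]

variable {g b : E} {θ : ℝ}

theorem planeVector_self (hg : ‖g‖ = Real.sin θ) (hb : ‖b‖ = Real.cos θ) :
    planeVector 𝕜 g b θ = g + b := by
  rw [planeVector, ofReal_smul_eq_smul (v := g) (s := 1), ofReal_smul_eq_smul (v := b) (s := 1)]
  · simp
  all_goals simp +contextual [hg, hb]

/-- The sign change reflects the plane in the line of `b`, and a second reflection, in a line at
angle `θ` to the first, makes it a rotation by `2 * θ`. -/
theorem reflection_planeVector (hgb : inner 𝕜 g b = 0) (hg : ‖g‖ = Real.sin θ)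
    (hb : ‖b‖ = Real.cos θ) {S : E ≃ₗᵢ[𝕜] E} (hSg : S g = -g) (hSb : S b = b) (φ : ℝ) :
    (Submodule.span 𝕜 {g + b}).reflection (S (planeVector 𝕜 g b φ)) =
      planeVector 𝕜 g b (φ + 2 * θ) := by
  have hbg : inner 𝕜 b g = 0 := inner_eq_zero_symm.1 hgb
  have hnorm : ‖g + b‖ ^ 2 = 1 := by
    rw [@norm_add_sq 𝕜, hgb, hg, hb]
    simp
  have hS : S (planeVector 𝕜 g b φ) =
      ((Real.cos φ / ‖b‖ : ℝ) : 𝕜) • b - ((Real.sin φ / ‖g‖ : ℝ) : 𝕜) • g := by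
    rw [planeVector, map_add, map_smul, map_smul, hSg, hSb, smul_neg, neg_add_eq_sub]
  have hinner : inner 𝕜 (g + b) (S (planeVector 𝕜 g b φ)) = (Real.cos (φ + θ) : ℝ) := by
    have hcos : Real.cos φ / ‖b‖ * ‖b‖ ^ 2 - Real.sin φ / ‖g‖ * ‖g‖ ^ 2 = Real.cos (φ + θ) := by
      rw [Real.cos_add, ← hg, ← hb]
      congr 1 <;> field_simp
    rw [hS, inner_sub_right, inner_smul_right, inner_smul_right, inner_add_left, inner_add_left,
      hgb, hbg, inner_self_eq_norm_sq_to_K, inner_self_eq_norm_sq_to_K, zero_add, add_zero, ← hcos]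
    push_cast
    rfl
  have hcoeff_g : ((2 * Real.cos (φ + θ) + Real.sin φ / ‖g‖ : ℝ) : 𝕜) • g =
      ((Real.sin (φ + 2 * θ) / ‖g‖ : ℝ) : 𝕜) • g := by
    apply ofReal_smul_eq_smul
    rcases eq_or_ne ‖g‖ 0 with h0 | h0
    · simp only [h0, mul_zero]
    · rw [add_mul, div_mul_cancel₀ _ h0, div_mul_cancel₀ _ h0, hg, Real.sin_add, Real.cos_add,
        Real.sin_two_mul, Real.cos_two_mul, Real.cos_sq']
      ring
  have hcoeff_b : ((2 * Real.cos (φ + θ) - Real.cos φ / ‖b‖ : ℝ) : 𝕜) • b =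
      ((Real.cos (φ + 2 * θ) / ‖b‖ : ℝ) : 𝕜) • b := by
    apply ofReal_smul_eq_smul
    rcases eq_or_ne ‖b‖ 0 with h0 | h0
    · simp only [h0, mul_zero]
    · rw [sub_mul, div_mul_cancel₀ _ h0, div_mul_cancel₀ _ h0, hb, Real.cos_add, Real.cos_add,
        Real.sin_two_mul, Real.cos_two_mul]
      ring
  rw [Submodule.reflection_singleton_apply, hinner, ← RCLike.ofReal_pow, hnorm, hS, planeVector,
    ← hcoeff_g, ← hcoeff_b]
  push_cast
  module

theorem grover_iterate (hgb : inner 𝕜 g b = 0) (hg : ‖g‖ = Real.sin θ)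
    (hb : ‖b‖ = Real.cos θ) {S : E ≃ₗᵢ[𝕜] E} (hSg : S g = -g) (hSb : S b = b) (k : ℕ) :
    (((Submodule.span 𝕜 {g + b}).reflection * S) ^ k) (g + b) =
      planeVector 𝕜 g b ((2 * k + 1) * θ) := by
  induction k with
  | zero => simpa using (planeVector_self hg hb).symm
  | succ k ih =>
    rw [pow_succ', LinearIsometryEquiv.coe_mul, Function.comp_apply, ih,
      LinearIsometryEquiv.coe_mul, Function.comp_apply, reflection_planeVector hgb hg hb hSg hSb]
    congr 1
    push_cast
    ring

end Grover

section Search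

variable {κ : Type*}

/-- The uniform superposition of the basis vectors with labels in `A`. -/
def uniform (A : Finset κ) : EuclideanSpace ℂ κ :=
  open Classical in
  WithLp.toLp 2 fun l => if l ∈ A then (((√(A.card : ℝ))⁻¹ : ℝ) : ℂ) else 0

open Classical in
theorem norm_uniform_apply_sq (A : Finset κ) (l : κ) :
    ‖uniform A l‖ ^ 2 = if l ∈ A then (A.card : ℝ)⁻¹ else 0 := by
  change ‖if l ∈ A then (((√(A.card : ℝ))⁻¹ : ℝ) : ℂ) else 0‖ ^ 2 = _
  split_ifs <;> simp

variable [Fintype κ]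

/-- The unitary that changes the sign of the basis vectors with labels in `L`. -/
def signFlip (L : Set κ) : EuclideanSpace ℂ κ ≃ₗᵢ[ℂ] EuclideanSpace ℂ κ :=
  open Classical in
  LinearIsometryEquiv.piLpCongrRight 2 fun l =>
    if l ∈ L then LinearIsometryEquiv.neg ℂ else LinearIsometryEquiv.refl ℂ ℂ

theorem signFlip_restrict (L : Set κ) (ψ : EuclideanSpace ℂ κ) :
    signFlip L (restrict L ψ) = -restrict L ψ := by
  ext l
  by_cases hl : l ∈ L <;> simp [signFlip, restrict_apply, hl]

theorem signFlip_restrict_compl (L : Set κ) (ψ : EuclideanSpace ℂ κ) :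
    signFlip L (restrict Lᶜ ψ) = restrict Lᶜ ψ := by
  ext l
  by_cases hl : l ∈ L <;> simp [signFlip, restrict_apply, hl]

theorem inner_restrict_restrict_compl (L : Set κ) (ψ : EuclideanSpace ℂ κ) :
    inner ℂ (restrict L ψ) (restrict Lᶜ ψ) = 0 := by
  rw [PiLp.inner_apply]
  refine Finset.sum_eq_zero fun l _ => ?_
  by_cases hl : l ∈ L <;> simp [restrict_apply, hl]

/-- The state after `k` rounds of amplitude amplification of the labels in `L`, starting from
`Φ`. -/
def amplify (L : Set κ) (Φ : EuclideanSpace ℂ κ) (k : ℕ) : EuclideanSpace ℂ κ :=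
  (((Submodule.span ℂ {Φ}).reflection * signFlip L) ^ k) Φ

theorem amplify_eq_planeVector {L : Set κ} {Φ : EuclideanSpace ℂ κ} (hΦ : ‖Φ‖ = 1) (k : ℕ) :
    amplify L Φ k = planeVector ℂ (restrict L Φ) (restrict Lᶜ Φ)
      ((2 * k + 1) * Real.arcsin ‖restrict L Φ‖) := by
  have hnorm := norm_restrict_sq_add_norm_restrict_compl_sq L Φ
  rw [hΦ, one_pow] at hnorm
  have hsin : ‖restrict L Φ‖ = Real.sin (Real.arcsin ‖restrict L Φ‖) :=
    (Real.sin_arcsin (by linarith [norm_nonneg (restrict L Φ)])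
      (hΦ ▸ norm_restrict_le L Φ)).symm
  have hcos : ‖restrict Lᶜ Φ‖ = Real.cos (Real.arcsin ‖restrict L Φ‖) := by
    rw [Real.cos_arcsin, ← hnorm, add_sub_cancel_left, Real.sqrt_sq (norm_nonneg _)]
  rw [← grover_iterate (inner_restrict_restrict_compl L Φ) hsin hcos (signFlip_restrict L Φ)
    (signFlip_restrict_compl L Φ), restrict_add_restrict_compl]
  rfl

theorem amplify_apply_eq_zero {L : Set κ} {Φ : EuclideanSpace ℂ κ} (hΦ : ‖Φ‖ = 1) (k : ℕ) {l : κ}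
    (hl : Φ l = 0) : amplify L Φ k l = 0 := by
  have hzero (L' : Set κ) : restrict L' Φ l = 0 := by
    rw [restrict_apply, Set.indicator_apply_eq_zero]
    exact fun _ => hl
  simp [amplify_eq_planeVector hΦ, planeVector, hzero]

theorem two_div_pi_mul_le_sin_div_sin {θ s : ℝ} (hθ₀ : 0 < θ) (hθ : θ ≤ Real.pi / 2) (hs : 0 ≤ s)
    (hsθ : s * Real.sin θ ≤ 1) : 2 / Real.pi * s ≤ Real.sin (s * θ) / Real.sin θ := by
  have hsin : 0 < Real.sin θ := Real.sin_pos_of_pos_of_lt_pi hθ₀ (by linarith [Real.pi_pos])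
  have hle : s * θ ≤ Real.pi / 2 := by
    have hjordan := mul_le_mul_of_nonneg_left (Real.mul_le_sin hθ₀.le hθ) hs
    calc s * θ = Real.pi / 2 * (s * (2 / Real.pi * θ)) := by field_simp
      _ ≤ Real.pi / 2 * 1 := by gcongr; exact hjordan.trans hsθ
      _ = Real.pi / 2 := mul_one _
  rw [le_div_iff₀ hsin]
  calc 2 / Real.pi * s * Real.sin θ ≤ 2 / Real.pi * s * θ := by
        gcongr
        exact Real.sin_le hθ₀.le
    _ = 2 / Real.pi * (s * θ) := mul_assoc ..
    _ ≤ Real.sin (s * θ) := Real.mul_le_sin (by positivity) hle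

theorem le_norm_amplify_apply_sq {L : Set κ} {Φ : EuclideanSpace ℂ κ} (hΦ : ‖Φ‖ = 1) {k : ℕ}
    (hk : (2 * k + 1) * ‖restrict L Φ‖ ≤ 1) {l : κ} (hl : l ∈ L) :
    2 / 5 * (2 * k + 1) ^ 2 * ‖Φ l‖ ^ 2 ≤ ‖amplify L Φ k l‖ ^ 2 := by
  rcases (norm_nonneg (restrict L Φ)).eq_or_lt' with hzero | hpos
  · have hl0 : Φ l = 0 := by
      simpa [restrict_apply, hl] using congrArg (· l) (norm_eq_zero.1 hzero)
    simp [hl0]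
  set θ := Real.arcsin ‖restrict L Φ‖ with hθ
  have hsin : Real.sin θ = ‖restrict L Φ‖ :=
    Real.sin_arcsin (by linarith) (hΦ ▸ norm_restrict_le L Φ)
  have hbound : 2 / Real.pi * (2 * k + 1) ≤ Real.sin ((2 * k + 1) * θ) / Real.sin θ :=
    two_div_pi_mul_le_sin_div_sin (Real.arcsin_pos.2 hpos) (Real.arcsin_le_pi_div_two _)
      (by positivity) (by rwa [hsin])
  have hcoeff : 2 / 5 * (2 * k + 1) ^ 2 ≤
      (Real.sin ((2 * k + 1) * θ) / ‖restrict L Φ‖) ^ 2 := by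
    rw [← hsin]
    refine le_trans ?_ (pow_le_pow_left₀ (by positivity) hbound 2)
    rw [mul_pow, div_pow]
    refine mul_le_mul_of_nonneg_right ?_ (by positivity)
    rw [div_le_div_iff₀ (by norm_num) (by positivity)]
    nlinarith [Real.pi_lt_d2, Real.pi_pos]
  have happly : amplify L Φ k l =
      ((Real.sin ((2 * k + 1) * θ) / ‖restrict L Φ‖ : ℝ) : ℂ) * Φ l := by
    simp [amplify_eq_planeVector hΦ, planeVector, restrict_apply, hl, ← hθ]
  rw [happly, norm_mul, Complex.norm_real, mul_pow, Real.norm_eq_abs, sq_abs]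
  gcongr

theorem norm_restrict_uniform_sq (L : Set κ) [DecidablePred (· ∈ L)] (A : Finset κ) :
    ‖restrict L (uniform A)‖ ^ 2 = (A.filter (· ∈ L)).card / A.card := by
  classical
  simp_rw [norm_restrict_sq, norm_uniform_apply_sq, ← ite_and]
  rw [← Finset.sum_filter, Finset.sum_const, nsmul_eq_mul, div_eq_mul_inv]
  congr 3
  ext l
  simp [and_comm]

theorem norm_uniform {A : Finset κ} (hA : A.Nonempty) : ‖uniform A‖ = 1 := by
  classical
  rw [← sq_eq_sq₀ (norm_nonneg _) zero_le_one, EuclideanSpace.norm_sq_eq]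
  simp [norm_uniform_apply_sq, hA.ne_empty]

theorem amplify_uniform_apply_eq_zero {A : Finset κ} (hA : A.Nonempty) (L : Set κ) (k : ℕ) {l : κ}
    (hl : l ∉ A) : amplify L (uniform A) k l = 0 :=
  amplify_apply_eq_zero (norm_uniform hA) k (if_neg hl)

theorem le_norm_amplify_uniform_apply_sq {L : Set κ} [DecidablePred (· ∈ L)] {A : Finset κ}
    {k : ℕ} (hk : (2 * k + 1) ^ 2 * (A.filter (· ∈ L)).card ≤ A.card) {l : κ} (hlA : l ∈ A)
    (hlL : l ∈ L) :
    2 / 5 * (2 * k + 1) ^ 2 / (A.card : ℝ) ≤ ‖amplify L (uniform A) k l‖ ^ 2 := by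
  have hcard : (0 : ℝ) < A.card := by exact_mod_cast Finset.card_pos.2 ⟨l, hlA⟩
  refine le_trans (by rw [norm_uniform_apply_sq, if_pos hlA, div_eq_mul_inv])
    (le_norm_amplify_apply_sq (norm_uniform ⟨l, hlA⟩) ?_ hlL)
  rw [← sq_le_one_iff₀ (by positivity), mul_pow, norm_restrict_uniform_sq, ← mul_div_assoc,
    div_le_one hcard]
  exact_mod_cast hk

theorem permute_uniform (σ : Equiv.Perm κ) (A : Finset κ) :
    permute σ (uniform A) = uniform (A.map σ.toEmbedding) := by
  classical
  ext l
  change (if σ.symm l ∈ A then _ else _) = if l ∈ A.map σ.toEmbedding then _ else _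
  simp only [Finset.mem_map_equiv, Finset.card_map]

end Search

theorem reflection_span_map {𝕜 E : Type*} [RCLike 𝕜] [NormedAddCommGroup E]
    [InnerProductSpace 𝕜 E] (V : E ≃ₗᵢ[𝕜] E) (ψ : E) :
    (Submodule.span 𝕜 {V ψ}).reflection = V * (Submodule.span 𝕜 {ψ}).reflection * V⁻¹ := by
  ext φ
  change _ = V ((Submodule.span 𝕜 {ψ}).reflection (V.symm φ))
  simp [Submodule.reflection_singleton_apply, LinearIsometryEquiv.inner_map_eq_flip]

/-- The reflection in `V x ψ` is the conjugate by `V x` of the reflection in `ψ`, so it costs one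
run of `V x` and one of its inverse. -/
theorem Implements.exists_amplify {ι W : Type} [Fintype ι] [Fintype W] {T : ℕ}
    {V : (ι → Bool) → StateSpace ι W ≃ₗᵢ[ℂ] StateSpace ι W} (h : Implements T V)
    (L : Set (BasisLabel ι W)) (ψ : StateSpace ι W) (k : ℕ) :
    ∃ G, Implements ((2 * k + 1) * T) G ∧ ∀ x, G x ψ = amplify L (V x ψ) k := by
  have hG := ((((h.mul (.const (Submodule.span ℂ {ψ}).reflection)).mul h.inv).mul
    (.const (signFlip L))).pow k).mul h
  refine ⟨_, by convert hG using 1; ring, fun x => ?_⟩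
  rw [amplify, reflection_span_map]
  rfl

section Read

variable {ι α δ : Type} (F : α → δ → Option ι)

/-- The bits of `x` at the positions `F u`, where the bit at the position `none` is `false`. -/
def row (x : ι → Bool) (u : α) (s : δ) : Bool := (F u s).elim false x

/-- The basis labels with idle query registers whose workspace holds an element `u` and the memory
contents `mem u`. -/
def registers (ι : Type) {α δ : Type} [Fintype α] (mem : α → δ → Bool) :
    Finset (BasisLabel ι (α × (δ → Bool))) :=
  Finset.univ.map ⟨fun u => (none, false, u, mem u), fun _ _ h => congrArg (·.2.2.1) h⟩

section Load

variable [DecidableEq ι]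

/-- The exchange of the query index `0` with the position `F u s`, where `u` is the element in the
workspace. -/
def indexSwap (s : δ) : Equiv.Perm (BasisLabel ι (α × (δ → Bool))) :=
  Function.Involutive.toPerm (fun l => (Equiv.swap none (F l.2.2.1 s) l.1, l.2)) fun l => by simp

/-- The exchange of the query bit with the memory bit `s`. -/
def bitSwap (ι α : Type) {δ : Type} [DecidableEq δ] (s : δ) :
    Equiv.Perm (BasisLabel ι (α × (δ → Bool))) :=
  Function.Involutive.toPerm
    (fun l => (l.1, l.2.2.2 s, l.2.2.1, Function.update l.2.2.2 s l.2.1)) fun l => by simp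

variable [DecidableEq δ]

/-- The effect on the basis labels of loading the bit at the position `F u s` into the memory
bit `s`. -/
def load (x : ι → Bool) (s : δ) : Equiv.Perm (BasisLabel ι (α × (δ → Bool))) :=
  bitSwap ι α s * indexSwap F s * (queryFun_involutive x).toPerm * indexSwap F s

theorem load_apply (x : ι → Bool) {s : δ} (u : α) {m : δ → Bool} (hm : m s = false) :
    load F x s (none, false, u, m) =
      (none, false, u, Function.update m s (row F x u s)) := by
  have hquery : queryFun x (F u s, false, u, m) = (F u s, row F x u s, u, m) := by
    rw [row]
    cases F u s <;> simp [queryFun]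
  change bitSwap ι α s (indexSwap F s (queryFun x
    (Equiv.swap none (F u s) none, false, u, m))) = _
  rw [Equiv.swap_apply_left, hquery]
  change (Equiv.swap none (F u s) (F u s), m s, u, Function.update m s (row F x u s)) = _
  rw [Equiv.swap_apply_right, hm]

variable [Fintype ι] [Fintype α] [Fintype δ]

theorem implements_load (s : δ) :
    Implements 1 fun x => permute (load F x s : Equiv.Perm (BasisLabel ι (α × (δ → Bool)))) := by
  convert ((Implements.const (permute (bitSwap ι α s * indexSwap F s))).mul implements_oracle).mul
    (.const (permute (indexSwap F s))) using 1
  ext x ψ l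
  rfl

end Load

variable [Fintype ι] [Fintype α] [Fintype δ] [DecidableEq δ]

theorem exists_implements_load_finset (t : Finset δ) :
    ∃ σ : (ι → Bool) → Equiv.Perm (BasisLabel ι (α × (δ → Bool))),
      (Implements t.card fun x => permute (σ x)) ∧ ∀ x u,
        σ x (none, false, u, fun _ => false) =
          (none, false, u, fun s => if s ∈ t then row F x u s else false) := by
  classical
  induction t using Finset.induction_on with
  | empty => exact ⟨fun _ => 1, .const 1, fun x u => by simp⟩
  | insert s t hs ih =>
    obtain ⟨σ, hσ, h⟩ := ih
    refine ⟨fun x => load F x s * σ x, ?_, fun x u => ?_⟩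
    · rw [Finset.card_insert_of_notMem hs]
      simpa only [permute_mul, Pi.mul_def] using (implements_load F s).mul hσ
    · rw [Equiv.Perm.mul_apply, h]
      refine (load_apply F x u (if_neg hs)).trans ?_
      congr 3
      funext s'
      rcases eq_or_ne s' s with rfl | hs' <;> simp_all

theorem exists_implements_read :
    ∃ V : (ι → Bool) → StateSpace ι (α × (δ → Bool)) ≃ₗᵢ[ℂ] StateSpace ι (α × (δ → Bool)),
      Implements (Fintype.card δ) V ∧ ∀ x, V x (uniform (registers ι fun _ _ => false)) =
        uniform (registers ι (row F x)) := by
  classical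
  obtain ⟨σ, hσ, h⟩ := exists_implements_load_finset F Finset.univ
  refine ⟨_, hσ, fun x => ?_⟩
  rw [permute_uniform, registers, Finset.map_map]
  congr 2
  ext1 u
  have hu := h x u
  simp only [Finset.mem_univ, if_true] at hu
  exact hu

end Read

section RealizesSearch

variable {ι α δ S : Type} [Fintype ι] [Fintype α] [Fintype δ]

theorem map_congr_of_apply_ne_zero {κ γ : Type*} (p : PMF κ) {f g : κ → γ}
    (h : ∀ l, p l ≠ 0 → f l = g l) : p.map f = p.map g := by
  classical
  ext c
  rw [PMF.map_apply, PMF.map_apply]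
  refine tsum_congr fun l => ?_
  by_cases hl : p l = 0
  · simp [hl]
  · rw [h l hl]

/-- The initial state costs one reading of the bits, and each of the `k` Grover iterations undoes
the reading and repeats it. -/
theorem exists_realizes_search [Nonempty α] (F : α → δ → Option ι)
    (marked : S → α → (δ → Bool) → Prop) [∀ s u m, Decidable (marked s u m)] (k : ℕ) :
    ∃ K : (ι → Bool) → S → PMF (α × (δ → Bool)), Realizes ((2 * k + 1) * Fintype.card δ) K ∧
      ∀ x s, ∃ p : PMF α, K x s = p.map (fun u => (u, row F x u)) ∧
        ((2 * k + 1) ^ 2 * (Finset.univ.filter fun u => marked s u (row F x u)).card ≤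
          Fintype.card α → ∀ u, marked s u (row F x u) →
          ENNReal.ofReal (2 / 5 * (2 * k + 1) ^ 2 / Fintype.card α) ≤ p u) := by
  classical
  obtain ⟨V, hV, hread⟩ := exists_implements_read F
  set ψ := uniform (registers ι fun (_ : α) (_ : δ) => false)
  choose G hG hGV using fun s => hV.exists_amplify {l | marked s l.2.2.1 l.2.2.2} ψ k
  simp only [hread] at hGV
  have hne (mem : α → δ → Bool) : (registers ι mem).Nonempty := Finset.univ_nonempty.map
  have hψ : ‖ψ‖ = 1 := norm_uniform (hne fun _ _ => false)
  refine ⟨_, ⟨_, inferInstance, ψ, hψ, G, fun _ l => l.2.2, hG, fun _ _ => rfl⟩, fun x s =>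
    ⟨PMF.map (·.2.2.1) (born (G s x ψ) (((G s x).norm_map ψ).trans hψ)), ?_, fun hk u hu => ?_⟩⟩
  · rw [PMF.map_comp]
    refine map_congr_of_apply_ne_zero _ fun l hl => ?_
    have hmem : l ∈ registers ι (row F x) := by
      contrapose! hl
      rw [born_apply, hGV, amplify_uniform_apply_eq_zero (hne _) _ _ hl]
      simp
    obtain ⟨u, -, rfl⟩ := Finset.mem_map.1 hmem
    rfl
  · let l : BasisLabel ι (α × (δ → Bool)) := (none, false, u, row F x u)
    have hl : l ∈ registers ι (row F x) := Finset.mem_map_of_mem _ (Finset.mem_univ u)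
    have hcard : (registers ι (row F x)).card = Fintype.card α := Finset.card_map _
    have hmarked : ((registers ι (row F x)).filter
        (· ∈ {l | marked s l.2.2.1 l.2.2.2})).card =
        (Finset.univ.filter fun u => marked s u (row F x u)).card := by
      rw [registers, Finset.filter_map, Finset.card_map]
      rfl
    have hle := le_norm_amplify_uniform_apply_sq (k := k) (by rwa [hmarked, hcard]) hl
      (show l ∈ {l | marked s l.2.2.1 l.2.2.2} from hu)
    rw [hcard] at hle
    rw [PMF.map_apply]
    refine le_trans ?_ (ENNReal.le_tsum l)
    rw [if_pos rfl, born_apply, hGV]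
    exact ENNReal.ofReal_le_ofReal hle

end RealizesSearch

section Iteration

variable {S R : Type*}

theorem toOuterMeasure_add_compl (p : PMF R) (B : Set R) :
    p.toOuterMeasure B + p.toOuterMeasure Bᶜ = 1 := by
  rw [PMF.toOuterMeasure_apply, PMF.toOuterMeasure_apply, ← ENNReal.tsum_add, ← p.tsum_coe]
  exact tsum_congr fun a => congrFun (Set.indicator_self_add_compl B p) a

theorem toOuterMeasure_le_one (p : PMF R) (B : Set R) : p.toOuterMeasure B ≤ 1 :=
  le_self_add.trans_eq (toOuterMeasure_add_compl p B)

theorem toOuterMeasure_compl_eq_zero_iff (p : PMF R) (B : Set R) :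
    p.toOuterMeasure Bᶜ = 0 ↔ p.support ⊆ B :=
  (p.toOuterMeasure_apply_eq_zero_iff _).trans Set.disjoint_compl_right_iff_subset

theorem toOuterMeasure_bind_le (p : PMF S) (k : S → PMF R) (B : Set S) {C : Set R} {b c : ℝ≥0∞}
    (hB : ∀ s ∈ p.support, s ∈ B → (k s).toOuterMeasure C ≤ b)
    (hBc : ∀ s ∈ p.support, s ∉ B → (k s).toOuterMeasure C ≤ c) :
    (p.bind k).toOuterMeasure C ≤ p.toOuterMeasure B * b + c := by
  calc (p.bind k).toOuterMeasure C
      = ∑' s, p s * (k s).toOuterMeasure C := PMF.toOuterMeasure_bind_apply ..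
    _ ≤ ∑' s, (B.indicator p s * b + p s * c) := ENNReal.tsum_le_tsum fun s => by
        by_cases hp : s ∈ p.support
        · by_cases hs : s ∈ B
          · rw [Set.indicator_of_mem hs]
            exact (mul_le_mul_right (hB s hp hs) _).trans le_self_add
          · exact (mul_le_mul_right (hBc s hp hs) _).trans le_add_self
        · simp [(p.apply_eq_zero_iff s).2 hp]
    _ = p.toOuterMeasure B * b + c := by
        rw [ENNReal.tsum_add, ENNReal.tsum_mul_right, ENNReal.tsum_mul_right, p.tsum_coe, one_mul,
          PMF.toOuterMeasure_apply]

theorem support_iterKernel_subset {S : Type} {K : S → PMF S} {G : Set S}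
    (hG : ∀ s ∈ G, (K s).support ⊆ G) (r : ℕ) : ∀ s ∈ G, (iterKernel K r s).support ⊆ G := by
  induction r with
  | zero => simp [iterKernel]
  | succ r ih =>
    intro s hs t ht
    obtain ⟨s', hs', ht⟩ := (PMF.mem_support_bind_iff _ _ _).1 ht
    exact ih s' (hG s hs hs') ht

theorem toOuterMeasure_iterKernel_compl_le {S : Type} {K : S → PMF S} {G H : Set S} {q : ℝ≥0∞}
    (hG : ∀ s ∈ G, (K s).support ⊆ G) (hH : ∀ s ∈ H, (K s).support ⊆ H)
    (hq : ∀ s ∈ G, (K s).toOuterMeasure Hᶜ ≤ q) (r : ℕ) :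
    ∀ s ∈ G, (iterKernel K r s).toOuterMeasure Hᶜ ≤ q ^ r := by
  induction r with
  | zero => exact fun s _ => (toOuterMeasure_le_one _ _).trans_eq (pow_zero q).symm
  | succ r ih =>
    intro s hs
    have hbind := toOuterMeasure_bind_le (K s) (iterKernel K r) Hᶜ (C := Hᶜ) (b := q ^ r) (c := 0)
      (fun s' hs' _ => ih s' (hG s hs hs')) fun s' _ hs' =>
        ((toOuterMeasure_compl_eq_zero_iff _ _).2
          (support_iterKernel_subset hH r s' (not_not.1 hs'))).le
    rw [add_zero] at hbind
    exact hbind.trans ((mul_le_mul_left (hq s hs) _).trans_eq (pow_succ' q r).symm)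

end Iteration

section Improve

variable {α β : Type} [Fintype α] [LinearOrder β]

/-- The elements whose value exceeds the threshold `d`. -/
def above (f : α → β) (d : β) : Finset α :=
  Finset.univ.filter (d < f ·)

theorem mem_above {f : α → β} {d : β} {u : α} : u ∈ above f d ↔ d < f u := by
  simp [above]

theorem above_anti (f : α → β) {d d' : β} (h : d ≤ d') : above f d' ⊆ above f d := fun _ hu =>
  mem_above.2 (h.trans_lt (mem_above.1 hu))

theorem lt_mul_card_filter_above (f : α → β) {d : β} {M N : ℕ} (h : N < M * (above f d).card) :
    N < M * ((above f d).filter fun u => M * (above f (f u)).card ≤ N).card := by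
  classical
  by_contra! hle
  set B := (above f d).filter fun u => M * (above f (f u)).card ≤ N
  have hne : (above f d \ B).Nonempty := by
    rw [Finset.sdiff_nonempty]
    intro hsub
    exact (h.trans_le (Nat.mul_le_mul_left M (Finset.card_le_card hsub))).not_ge hle
  obtain ⟨u, hu, hmax⟩ := Finset.exists_max_image _ f hne
  obtain ⟨hu_above, huB⟩ := Finset.mem_sdiff.1 hu
  have hsub : above f (f u) ⊆ B := by
    intro v hv
    by_contra hvB
    have hdv : v ∈ above f d := above_anti f (mem_above.1 hu_above).le hv
    exact (mem_above.1 hv).not_ge (hmax v (Finset.mem_sdiff.2 ⟨hdv, hvB⟩))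
  exact huB (Finset.mem_filter.2
    ⟨hu_above, (Nat.mul_le_mul_left M (Finset.card_le_card hsub)).trans hle⟩)

/-- The state of a maximum search after the inspection of `u`: a state is the best element found so
far, with a lower bound of its value. -/
def improve (f : α → β) (s : α × β) (u : α) : α × β :=
  if s.2 < f u then (u, f u) else s

/-- The bound `s.2` is valid for the element `s.1`, and is exceeded by at most a fraction `9⁻ʲ` of
all elements. -/
def IsGood (f : α → β) (j : ℕ) (s : α × β) : Prop :=
  s.2 ≤ f s.1 ∧ 9 ^ j * (above f s.2).card ≤ Fintype.card α

theorem IsGood.improve {f : α → β} {j : ℕ} {s : α × β} (h : IsGood f j s) (u : α) :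
    IsGood f j (improve f s u) := by
  unfold QuantumQuery.improve
  split_ifs with hu
  · exact ⟨le_rfl, (Nat.mul_le_mul_left _ (Finset.card_le_card (above_anti f hu.le))).trans h.2⟩
  · exact h

theorem IsGood.le_of_card_lt {f : α → β} {j : ℕ} {s : α × β} (h : IsGood f j s)
    (hj : Fintype.card α < 9 ^ j) (u : α) : f u ≤ f s.1 := by
  refine le_trans (not_lt.1 fun hu => ?_) h.1
  have hcard : 1 ≤ (above f s.2).card := Finset.card_pos.2 ⟨u, mem_above.2 hu⟩
  exact hj.not_ge ((Nat.le_mul_of_pos_right _ hcard).trans h.2)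

/-- One inspection of a random element in a maximum search: if at most a fraction `9⁻ʲ` of all
elements are better than the current one, then each of these is inspected with the probability that
about `3ʲ` Grover iterations achieve. -/
def IsImprovementKernel (f : α → β) (j : ℕ) (K : α × β → PMF (α × β)) : Prop :=
  ∀ s, ∃ p : PMF α, K s = p.map (improve f s) ∧
    (9 ^ j * (above f s.2).card ≤ Fintype.card α → ∀ u ∈ above f s.2,
      ENNReal.ofReal (2 / 5 * 9 ^ j / Fintype.card α) ≤ p u)

namespace IsImprovementKernel

variable {f : α → β} {j : ℕ} {K : α × β → PMF (α × β)}

theorem support_subset (hK : IsImprovementKernel f j K) {i : ℕ} :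
    ∀ s ∈ {s | IsGood f i s}, (K s).support ⊆ {s | IsGood f i s} := by
  intro s hs t ht
  obtain ⟨p, hp, -⟩ := hK s
  rw [hp] at ht
  obtain ⟨u, -, rfl⟩ := (PMF.mem_support_map_iff _ _ _).1 ht
  exact IsGood.improve hs u

/-- More than a fraction `9 ^ (-(j + 1))` of all elements would improve the state sufficiently, and
each of them is inspected with probability at least `2 / 5 * 9 ^ j / card α`. -/
theorem le_toOuterMeasure (hK : IsImprovementKernel f j K) {s : α × β} (hs : IsGood f j s)
    (hs' : ¬ IsGood f (j + 1) s) :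
    ENNReal.ofReal (2 / 45) ≤ (K s).toOuterMeasure {s | IsGood f (j + 1) s} := by
  obtain ⟨p, hp, hpu⟩ := hK s
  set B := (above f s.2).filter fun u => 9 ^ (j + 1) * (above f (f u)).card ≤ Fintype.card α
  have hB : Fintype.card α < 9 ^ (j + 1) * B.card :=
    lt_mul_card_filter_above f (not_le.1 fun h => hs' ⟨hs.1, h⟩)
  have hBsub : (B : Set α) ⊆ improve f s ⁻¹' {s | IsGood f (j + 1) s} := by
    intro u hu
    obtain ⟨hu_above, hu_card⟩ := Finset.mem_filter.1 hu
    rw [Set.mem_preimage, improve, if_pos (mem_above.1 hu_above)]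
    exact ⟨le_rfl, hu_card⟩
  have hreal : (2 / 45 : ℝ) ≤ B.card * (2 / 5 * 9 ^ j / Fintype.card α) := by
    have hα : (0 : ℝ) < Fintype.card α := by exact_mod_cast Fintype.card_pos_iff.2 ⟨s.1⟩
    have hB' : (Fintype.card α : ℝ) ≤ 9 ^ (j + 1) * B.card := by exact_mod_cast hB.le
    rw [mul_div_assoc', le_div_iff₀ hα]
    rw [pow_succ] at hB'
    linarith
  calc ENNReal.ofReal (2 / 45)
      ≤ ENNReal.ofReal (B.card * (2 / 5 * 9 ^ j / Fintype.card α)) :=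
        ENNReal.ofReal_le_ofReal hreal
    _ = ∑ _u ∈ B, ENNReal.ofReal (2 / 5 * 9 ^ j / Fintype.card α) := by
        rw [ENNReal.ofReal_mul (Nat.cast_nonneg _), ENNReal.ofReal_natCast, Finset.sum_const,
          nsmul_eq_mul]
    _ ≤ ∑ u ∈ B, p u := Finset.sum_le_sum fun u hu => hpu hs.2 u (Finset.mem_filter.1 hu).1
    _ = p.toOuterMeasure B := (p.toOuterMeasure_apply_finset B).symm
    _ ≤ p.toOuterMeasure (improve f s ⁻¹' {s | IsGood f (j + 1) s}) :=
        p.toOuterMeasure.mono hBsub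
    _ = (K s).toOuterMeasure {s | IsGood f (j + 1) s} := by
        rw [hp, PMF.toOuterMeasure_map_apply]

theorem toOuterMeasure_compl_le (hK : IsImprovementKernel f j K) {s : α × β}
    (hs : IsGood f j s) :
    (K s).toOuterMeasure {s | IsGood f (j + 1) s}ᶜ ≤ ENNReal.ofReal (43 / 45) := by
  by_cases hs' : IsGood f (j + 1) s
  · rw [(toOuterMeasure_compl_eq_zero_iff _ _).2 (hK.support_subset s hs')]
    exact zero_le
  · have hadd : ENNReal.ofReal (2 / 45) + ENNReal.ofReal (43 / 45) = 1 := by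
      rw [← ENNReal.ofReal_add (by norm_num) (by norm_num)]
      norm_num
    refine (ENNReal.add_le_add_iff_left (ENNReal.ofReal_ne_top (r := 2 / 45))).1 ?_
    rw [hadd, ← toOuterMeasure_add_compl (K s) {s | IsGood f (j + 1) s}]
    exact add_le_add_left (hK.le_toOuterMeasure hs hs') _

theorem toOuterMeasure_iterKernel_le (hK : IsImprovementKernel f j K) (r : ℕ) {s : α × β}
    (hs : IsGood f j s) :
    (iterKernel K (32 * r) s).toOuterMeasure {s | IsGood f (j + 1) s}ᶜ ≤
      ENNReal.ofReal ((1 / 4) ^ r) := by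
  refine (toOuterMeasure_iterKernel_compl_le hK.support_subset hK.support_subset
    (fun s hs => hK.toOuterMeasure_compl_le hs) (32 * r) s hs).trans ?_
  rw [← ENNReal.ofReal_pow (by norm_num), pow_mul]
  exact ENNReal.ofReal_le_ofReal (pow_le_pow_left₀ (by positivity) (by norm_num) r)

end IsImprovementKernel

end Improve

section Maximum

variable {ι α β δ : Type} [Fintype ι] [Fintype α] [Fintype δ] [LinearOrder β]

theorem exists_realizes_isImprovementKernel [Nonempty α] (F : α → δ → Option ι)
    (val : α → (δ → Bool) → β) (j : ℕ) :
    ∃ K : (ι → Bool) → α × β → PMF (α × β), Realizes (3 ^ j * Fintype.card δ) K ∧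
      ∀ x, IsImprovementKernel (fun u => val u (row F x u)) j (K x) := by
  classical
  obtain ⟨k, hk⟩ := Odd.pow (n := j) (by decide : Odd 3)
  have hk' : (2 * k + 1 : ℝ) = 3 ^ j := by exact_mod_cast hk.symm
  have h9 (A : Type) [CommSemiring A] : ((3 : A) ^ j) ^ 2 = 9 ^ j := by
    rw [pow_right_comm]
    norm_num
  obtain ⟨K, hK, hKp⟩ := exists_realizes_search F (fun (s : α × β) u m => s.2 < val u m) k
  rw [← hk] at hK
  refine ⟨_, hK.map fun s p => if s.2 < val p.1 p.2 then (p.1, val p.1 p.2) else s,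
    fun x s => ?_⟩
  obtain ⟨p, hp, hpu⟩ := hKp x s
  rw [← hk, hk', h9, h9] at hpu
  exact ⟨p, by rw [hp, PMF.map_comp]; rfl, fun h u hu => hpu h u (Finset.mem_filter.1 hu).2⟩

/-- With `i` levels to go, the attempt to leave the current level is made `32 * i` times and fails
with probability at most `(1 / 4) ^ i`: the failure probabilities form a geometric series, and the
cost is dominated by the last levels. -/
theorem exists_realizes_isGood [Nonempty α] (F : α → δ → Option ι) (val : α → (δ → Bool) → β)
    (i j : ℕ) :
    ∃ (T : ℕ) (K : (ι → Bool) → α × β → PMF (α × β)),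
      T + 8 * 3 ^ j * (2 * i + 3) * Fintype.card δ = 24 * 3 ^ (i + j) * Fintype.card δ ∧
      Realizes T K ∧ ∀ x s, IsGood (fun u => val u (row F x u)) j s →
        (K x s).toOuterMeasure {s | IsGood (fun u => val u (row F x u)) (i + j) s}ᶜ ≤
          ENNReal.ofReal ((1 - (1 / 4) ^ i) / 3) := by
  induction i generalizing j with
  | zero =>
    refine ⟨0, _, by ring, realizes_pure, fun x s hs => ?_⟩
    rw [Nat.zero_add, (toOuterMeasure_compl_eq_zero_iff _ _).2 (by simpa using hs)]
    exact zero_le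
  | succ i ih =>
    obtain ⟨T, K₂, hT, hK₂, hfail⟩ := ih (j + 1)
    obtain ⟨K₁, hK₁, himp⟩ := exists_realizes_isImprovementKernel F val j
    refine ⟨_, _, ?_, (hK₁.iterKernel (32 * (i + 1))).bind hK₂, fun x s hs => ?_⟩
    · rw [Nat.add_right_comm i 1 j, Nat.add_assoc i j 1, ← hT]
      ring
    · rw [Nat.add_right_comm i 1 j, Nat.add_assoc i j 1]
      have hpow : (1 / 4 : ℝ) ^ i ≤ 1 := pow_le_one₀ (by norm_num) (by norm_num)
      calc _ ≤ _ * 1 + ENNReal.ofReal ((1 - (1 / 4) ^ i) / 3) :=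
            toOuterMeasure_bind_le _ _ {s | IsGood (fun u => val u (row F x u)) (j + 1) s}ᶜ
              (fun _ _ _ => toOuterMeasure_le_one _ _) fun s' _ hs' => hfail x s' (not_not.1 hs')
        _ ≤ ENNReal.ofReal ((1 / 4) ^ (i + 1)) + ENNReal.ofReal ((1 - (1 / 4) ^ i) / 3) := by
            rw [mul_one]
            exact add_le_add_left ((himp x).toOuterMeasure_iterKernel_le (i + 1) hs) _
        _ = ENNReal.ofReal ((1 - (1 / 4) ^ (i + 1)) / 3) := by
            rw [← ENNReal.ofReal_add (by positivity) (by linarith)]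
            ring_nf

theorem exists_computableWith_max [Nonempty α] [OrderBot β] {J : ℕ} (F : α → δ → Option ι)
    (val : α → (δ → Bool) → β) (hJ : Fintype.card α < 9 ^ J) :
    ∃ T ≤ 24 * 3 ^ J * Fintype.card δ, ComputableWith
      (fun x v => ∀ u, val u (row F x u) ≤ val v (row F x v)) T := by
  obtain ⟨T, K, hT, hK, hfail⟩ := exists_realizes_isGood F val J 0
  simp only [add_zero] at hT hfail
  refine ⟨T, hT ▸ Nat.le_add_right _ _,
    hK.computableWith (Classical.arbitrary α, ⊥) Prod.fst fun x => ?_⟩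
  have hstart : IsGood (fun u => val u (row F x u)) 0 (Classical.arbitrary α, ⊥) :=
    ⟨bot_le, by simpa using Finset.card_le_univ _⟩
  have hsub : {s : α × β | ¬ ∀ u, val u (row F x u) ≤ val s.1 (row F x s.1)} ⊆
      {s | IsGood (fun u => val u (row F x u)) J s}ᶜ :=
    fun s hs hgood => hs (IsGood.le_of_card_lt hgood hJ)
  calc _ ≤ ENNReal.ofReal ((1 - (1 / 4) ^ J) / 3) :=
        ((K x _).toOuterMeasure.mono hsub).trans (hfail x _ hstart)
    _ ≤ ENNReal.ofReal (1 / 3) :=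
        ENNReal.ofReal_le_ofReal (by linarith [pow_nonneg (by norm_num : (0 : ℝ) ≤ 1 / 4) J])
    _ = 1 / 3 := by
        rw [ENNReal.ofReal_div_of_pos (by norm_num), ENNReal.ofReal_one, ENNReal.ofReal_ofNat]

end Maximum

end QuantumQuery

namespace Tournament

/-- The edges at `u`, indexed by their other endpoint. -/
def edgesAt {n : ℕ} (u v : Fin n) : Option (Edge n) :=
  if h : u < v then some ⟨(u, v), h⟩ else if h : v < u then some ⟨(v, u), h⟩ else none

/-- The out-degree of `u` in terms of the bits of the edges at `u`. -/
def degreeOfRow {n : ℕ} (u : Fin n) (m : Fin n → Bool) : ℕ :=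
  (Finset.univ.filter fun v => (u < v ∧ m v = true) ∨ (v < u ∧ m v = false)).card

theorem degreeOfRow_row {n : ℕ} (T : Edge n → Bool) (u : Fin n) :
    degreeOfRow u (QuantumQuery.row edgesAt T u) = outDegree T u := by
  classical
  rw [degreeOfRow, outDegree]
  congr 1
  ext v
  simp only [Finset.mem_filter, Finset.mem_univ, true_and]
  rcases lt_trichotomy u v with h | rfl | h <;>
    simp [Arc, QuantumQuery.row, edgesAt, *, not_lt_of_gt]

theorem exists_computableWith_MOD {n : ℕ} (hn : n ≠ 0) :
    ∃ T ≤ 72 * 3 ^ Nat.log 9 n * n, QuantumQuery.ComputableWith (MOD n) T := by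
  have : NeZero n := ⟨hn⟩
  obtain ⟨T, hT, hMOD⟩ := QuantumQuery.exists_computableWith_max (J := Nat.log 9 n + 1)
    (edgesAt (n := n)) degreeOfRow
    ((Fintype.card_fin n).trans_lt (Nat.lt_pow_succ_log_self (by norm_num) n))
  simp only [degreeOfRow_row] at hMOD
  refine ⟨T, hT.trans_eq ?_, hMOD⟩
  rw [Fintype.card_fin]
  ring

theorem three_pow_log_nine_mul_le {n : ℕ} (hn : n ≠ 0) :
    (3 ^ Nat.log 9 n * n : ℝ≥0∞) ≤ (n : ℝ≥0∞) ^ (3 / 2 : ℝ) := by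
  have h9 : ((3 : ℝ≥0∞) ^ Nat.log 9 n) ^ (2 : ℝ) ≤ n := by
    rw [ENNReal.rpow_ofNat, pow_right_comm]
    exact_mod_cast Nat.pow_log_le_self 9 hn
  have h3 : (3 : ℝ≥0∞) ^ Nat.log 9 n ≤ (n : ℝ≥0∞) ^ (1 / 2 : ℝ) := by
    rwa [one_div, ENNReal.le_rpow_inv_iff (by norm_num)]
  calc (3 ^ Nat.log 9 n * n : ℝ≥0∞)
      ≤ (n : ℝ≥0∞) ^ (1 / 2 : ℝ) * (n : ℝ≥0∞) ^ (1 : ℝ) := by rw [ENNReal.rpow_one]; gcongr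
    _ = (n : ℝ≥0∞) ^ (3 / 2 : ℝ) := by
        rw [← ENNReal.rpow_add_of_nonneg _ _ (by norm_num) (by norm_num)]
        norm_num

end Tournament

end

theorem mainTheorem5 :
    (∃ C : ℝ≥0, ∀ n : ℕ, 1 ≤ n →
      (QuantumQuery.Q (Tournament.MOD n) : ℝ≥0∞) ≤ C * (n : ℝ≥0∞) ^ (3 / 2 : ℝ)) ∧
    (∃ c : ℝ≥0, 0 < c ∧ ∀ n : ℕ, 2 ≤ n →
      (c : ℝ≥0∞) * n ≤ (QuantumQuery.Q (Tournament.MOD n) : ℝ≥0∞)) := by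
  refine ⟨⟨72, fun n hn => ?_⟩, ⟨64⁻¹, by positivity, fun n hn => ?_⟩⟩
  · obtain ⟨T, hT, hMOD⟩ := Tournament.exists_computableWith_MOD (Nat.one_le_iff_ne_zero.1 hn)
    calc (QuantumQuery.Q (Tournament.MOD n) : ℝ≥0∞)
        ≤ T := QuantumQuery.Q_le hMOD
      _ ≤ 72 * (3 ^ Nat.log 9 n * n) := by exact_mod_cast hT.trans_eq (mul_assoc ..)
      _ ≤ (72 : ℝ≥0) * (n : ℝ≥0∞) ^ (3 / 2 : ℝ) := by
          push_cast
          gcongr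
          exact Tournament.three_pow_log_nine_mul_le (Nat.one_le_iff_ne_zero.1 hn)
  · refine QuantumQuery.le_Q fun T hMOD => ?_
    have hT : (n : ℝ≥0∞) ≤ 64 * T := by
      exact_mod_cast Tournament.le_mul_of_computableWith_MOD hn hMOD
    rw [ENNReal.coe_inv (by norm_num), ENNReal.coe_ofNat, ← ENNReal.div_eq_inv_mul]
    exact ENNReal.div_le_of_le_mul' hT
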